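/- For $\alpha>0$ let $\psi_\alpha(x)=\exp(x^\alpha)-1$ for $x\ge 0$, and for a real random variable $W$ put $\|W\|_{\psi_\alpha}=\inf\{\eta>0:\mathbb E[\psi_\alpha(|W|/\eta)]\le 1\}\in[0,\infty]$. For a random vector $X\in\mathbb R^p$ with coordinates $X(1),\dots,X(p)$ put $$\|X\|_{M,\psi_\alpha}=\max_{1\le j\le p}\|X(j)\|_{\psi_\alpha},\qquad \|X\|_{J,\psi_\alpha}=\sup_{\|\theta\|_2=1}\|X^\top\theta\|_{\psi_\alpha}.$$ **Theorem.** Fix $0<\alpha\le 2$. There is a constant $C_\alpha>0$ depending only on $\alpha$ such that the following holds for all integers $n,p\ge 1$ and $k\ge 2$, all independent (not necessarily identically distributed) random vectors $X_1,\dots,X_n$ in $\mathbb R^p$, and all real $K_{n,p}\ge 0$. Let $$\hat\Sigma_n=\frac1n\sum_{i=1}^n X_iX_i^\top,\qquad \Sigma_n=\frac1n\sum_{i=1}^n\mathbb E[X_iX_i^\top],\qquad \Upsilon_{n,k}=\sup_{\|\theta\|_0\le k,\ \|\theta\|_2=1}\frac1n\sum_{i=1}^n\mathrm{Var}\big((X_i^\top\theta)^2\big),$$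 where $\|\theta\|_0$ is the number of nonzero entries of $\theta$, and let $\lambda_{\min}(\Sigma_n)$ be the smallest eigenvalue of $\Sigma_n$. (a) If $\|X_i\|_{M,\psi_\alpha}\le K_{n,p}$ for all $1\le i\le n$, then, with $$\Xi=\Xi^{(M)}_{n,k}:=14\sqrt2\sqrt{\frac{\Upsilon_{n,k}\,k\log(36np/k)}{n}}+\frac{C_\alpha K_{n,p}^2\,k\,(\log(2n))^{2/\alpha}(k\log(36np/k))^{2/\alpha}}{n},$$ with probability at least $1-3k(np)^{-1}$, simultaneously for all $\theta\in\mathbb R^p$, $$\theta^\top\hat\Sigma_n\theta\ \ge\ \big(\lambda_{\min}(\Sigma_n)-27\,\Xi\big)\|\theta\|_2^2-\frac{54\,\Xi}{k}\|\theta\|_1^2. \qquad (*)$$ (b) If $\|X_i\|_{J,\psi_\alpha}\le K_{n,p}$ for all $1\le i\le n$, then $(*)$ holds for all $\theta\in\mathbb R^p$ simultaneously, with probability at least $1-3k(np)^{-1}$, with $$\Xi=\Xi^{(J)}_{n,k}:=14\sqrt2\sqrt{\frac{\Upsilon_{n,k}\,k\log(36np/k)}{n}}+\frac{C_\alpha K_{n,p}^2(\log(2n))^{2/\alpha}(k\log(36np/k))^{2/\alpha}}{n}.$$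 Moreover, in each of the two cases (with the corresponding $\Xi$), if $\lambda_{\min}(\Sigma_n)>0$ and $\lambda_{\min}(\Sigma_n)\ge 1782\,\Xi$, then at every outcome where $(*)$ holds for all $\theta$, and hence with probability at least $1-3k(np)^{-1}$, the restricted eigenvalue condition holds with cone parameter $3$ and constant $\lambda_{\min}(\Sigma_n)/2>0$: $$\frac{\theta^\top\hat\Sigma_n\theta}{\theta^\top\theta}\ \ge\ \frac{\lambda_{\min}(\Sigma_n)}{2}$$ for all $S\subseteq\{1,\dots,p\}$ with $|S|\le k$ and all $\theta\ne0$ with $\sum_{j\notin S}|\theta(j)|\le 3\sum_{j\in S}|\theta(j)|$. -/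

import Mathlib

open MeasureTheory ProbabilityTheory
open scoped ENNReal NNReal Matrix

noncomputable section

namespace SubWeibull

/-- The `g`-Orlicz norm `inf {η > 0 : E[g(|X|/η)] ≤ 1}` of a random variable, as an extended
nonnegative real (it is `∞` if no such `η` exists). -/
def orliczNorm {Ω : Type*} [MeasurableSpace Ω] (g : ℝ → ℝ) (X : Ω → ℝ) (μ : Measure Ω) : ℝ≥0∞ :=
  ⨅ (η : ℝ) (_ : 0 < η) (_ : ∫⁻ ω, ENNReal.ofReal (g (|X ω| / η)) ∂μ ≤ 1), ENNReal.ofReal η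

/-- `ψ_α(x) = exp(x^α) - 1`, used for `x ≥ 0`. -/
def psi (α x : ℝ) : ℝ := Real.exp (x ^ α) - 1

/-- The marginal sub-Weibull norm: the supremum over coordinates `j` of the `ψ_α`-norm
of `X(j)`. -/
def marginalNorm {Ω : Type*} [MeasurableSpace Ω] {p : ℕ} (α : ℝ)
    (X : Ω → EuclideanSpace ℝ (Fin p)) (μ : Measure Ω) : ℝ≥0∞ :=
  ⨆ j : Fin p, orliczNorm (psi α) (fun ω => X ω j) μ

/-- The joint sub-Weibull norm: the supremum over Euclidean unit vectors `θ` of the `ψ_α`-norm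
of `Xᵀθ`. -/
def jointNorm {Ω : Type*} [MeasurableSpace Ω] {p : ℕ} (α : ℝ)
    (X : Ω → EuclideanSpace ℝ (Fin p)) (μ : Measure Ω) : ℝ≥0∞ :=
  ⨆ (θ : EuclideanSpace ℝ (Fin p)) (_ : ‖θ‖ = 1),
    orliczNorm (psi α) (fun ω => X ω ⬝ᵥ θ) μ

/-- The sample gram matrix `(1/n) ∑ᵢ XᵢXᵢᵀ` at the outcome `ω`. -/
def sampleGram {Ω : Type*} {n p : ℕ} (X : Fin n → Ω → EuclideanSpace ℝ (Fin p)) (ω : Ω) :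
    Matrix (Fin p) (Fin p) ℝ :=
  Matrix.of fun j l => (1 / (n : ℝ)) * ∑ i, X i ω j * X i ω l

/-- The population gram matrix `(1/n) ∑ᵢ E[XᵢXᵢᵀ]`. -/
def popGram {Ω : Type*} [MeasurableSpace Ω] {n p : ℕ}
    (X : Fin n → Ω → EuclideanSpace ℝ (Fin p)) (μ : Measure Ω) : Matrix (Fin p) (Fin p) ℝ :=
  Matrix.of fun j l => (1 / (n : ℝ)) * ∑ i, ∫ ω, X i ω j * X i ω l ∂μ

/-- The smallest (real) eigenvalue of a square matrix; it is used for real symmetric matrices of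
positive size, whose spectrum is a nonempty finite set of reals. -/
def lambdaMin {p : ℕ} (A : Matrix (Fin p) (Fin p) ℝ) : ℝ := sInf (spectrum ℝ A)

/-- The quadratic form `θᵀAθ`. -/
def quadForm {p : ℕ} (A : Matrix (Fin p) (Fin p) ℝ) (θ : EuclideanSpace ℝ (Fin p)) : ℝ :=
  θ ⬝ᵥ A *ᵥ θ

/-- The `ℓ¹` norm of a vector. -/
def l1Norm {p : ℕ} (θ : EuclideanSpace ℝ (Fin p)) : ℝ := ∑ j, |θ j|

/-- The set `Θ_k` of Euclidean unit vectors with at most `k` nonzero entries. -/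
def sparseSphere (p k : ℕ) : Set (EuclideanSpace ℝ (Fin p)) :=
  {θ | {j : Fin p | θ j ≠ 0}.ncard ≤ k ∧ ‖θ‖ = 1}

/-- `Υ_{n,k} = sup_{θ ∈ Θ_k} (1/n) ∑ᵢ Var((Xᵢᵀθ)²)`. -/
def upsilon {Ω : Type*} [MeasurableSpace Ω] {n p : ℕ}
    (X : Fin n → Ω → EuclideanSpace ℝ (Fin p)) (μ : Measure Ω) (k : ℕ) : ℝ :=
  ⨆ θ : sparseSphere p k,
    (1 / (n : ℝ)) * ∑ i, variance (fun ω => (X i ω ⬝ᵥ (θ : EuclideanSpace ℝ (Fin p))) ^ 2) μ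

/-- `Ξ^{(M)}_{n,k}`, as a function of the constant `C`, the order `α`, the norm bound `K` and
the value `U` of `Υ_{n,k}`. -/
def xiM (C α K U : ℝ) (n p k : ℕ) : ℝ :=
  14 * √2 * √(U * k * Real.log (36 * n * p / k) / n)
    + C * K ^ 2 * k * Real.log (2 * n) ^ (2 / α) * (k * Real.log (36 * n * p / k)) ^ (2 / α) / n

/-- `Ξ^{(J)}_{n,k}`, as a function of the constant `C`, the order `α`, the norm bound `K` and
the value `U` of `Υ_{n,k}`. -/
def xiJ (C α K U : ℝ) (n p k : ℕ) : ℝ :=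
  14 * √2 * √(U * k * Real.log (36 * n * p / k) / n)
    + C * K ^ 2 * Real.log (2 * n) ^ (2 / α) * (k * Real.log (36 * n * p / k)) ^ (2 / α) / n

/-- The restricted strong convexity inequality
`θᵀAθ ≥ (lam - 27 Ξ)‖θ‖₂² - (54 Ξ / k)‖θ‖₁²`, simultaneously for all `θ`. -/
def RSC {p : ℕ} (A : Matrix (Fin p) (Fin p) ℝ) (lam Ξ : ℝ) (k : ℕ) : Prop :=
  ∀ θ : EuclideanSpace ℝ (Fin p),
    quadForm A θ ≥ (lam - 27 * Ξ) * ‖θ‖ ^ 2 - 54 * Ξ / k * l1Norm θ ^ 2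

/-- The cone `C(S; δ)` of all `θ` with `‖θ(Sᶜ)‖₁ ≤ δ ‖θ(S)‖₁`. -/
def cone {p : ℕ} (S : Finset (Fin p)) (δ : ℝ) : Set (EuclideanSpace ℝ (Fin p)) :=
  {θ | ∑ j ∈ Sᶜ, |θ j| ≤ δ * ∑ j ∈ S, |θ j|}

/-- The restricted eigenvalue condition: the infimum of `θᵀAθ / θᵀθ` over nonzero `θ ∈ C(S; δ)`
and `|S| ≤ k` is at least `γ`, and `γ > 0`. -/
def RestrictedEigenvalue {p : ℕ} (A : Matrix (Fin p) (Fin p) ℝ) (k : ℕ) (δ γ : ℝ) : Prop :=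
  0 < γ ∧ ∀ S : Finset (Fin p), S.card ≤ k → ∀ θ ∈ cone S δ, θ ≠ 0 →
    quadForm A θ / (θ ⬝ᵥ θ) ≥ γ

end SubWeibull

end

/-! The argument is a Maurey-type sampling argument combined with one-sided concentration. Rescale
`v` to weights `|v j| / ‖v‖₁`, draw `k` indices independently and add the corresponding signed basis
vectors. The expected value of a quadratic form at this random `k`-sparse vector is `k(k-1)` times
the form at `v / ‖v‖₁`, plus `k` times the averaged diagonal. Hence a form that is nonnegative at
all sums of `k` signed basis vectors is at least `-(d/(k-1)) ‖v‖₁²` everywhere, where `d` bounds its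
diagonal (`quadForm_ge_neg_l1Norm_sq`). Applied to `Σ̂ - Σ + ξ I`, this reduces the uniform bound to
a lower deviation at finitely many sparse vectors and an upper deviation of the `p` diagonal entries
(`RSC_of_signedSums`).

The lower deviation is cheap: `E Y - Y ≤ E Y` for `Y = (Xᵀθ)² ≥ 0`, so Bernstein's inequality needs
only a variance and a second moment. Heavy tails matter only on the diagonal, where truncation at a
level of order `(log 2n)^(2/α)` leaves an excess with an `n`-free tail
(`measureReal_sum_excess_ge_le`).

A signed sum depends only on a multiset, so there are at most `(36np/k)^k` of them, and deviation
level `s = 3k log(36np/k)` absorbs this count. Cases (a) and (b) differ only in the factor `κ` in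
the second moment of `Xᵀθ`: `k` by Cauchy–Schwarz on the support, or `1`. The restricted eigenvalue
condition then follows from `‖θ‖₁² ≤ 16k ‖θ‖₂²` on the cone. -/

namespace SubWeibull

/-! ### Moments of sums over an i.i.d. sample of indices -/

section Averaging

variable {ι : Type*} [Fintype ι]

lemma sum_fin_succ_fun (k : ℕ) (F : (Fin (k + 1) → ι) → ℝ) :
    ∑ f, F f = ∑ j, ∑ f : Fin k → ι, F (Fin.cons j f) := by
  rw [← Fintype.sum_prod_type']
  exact (Fintype.sum_equiv (Fin.consEquiv fun _ => ι) _ _ fun _ => rfl).symm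

/-- The product weights of a probability vector sum to one. -/
lemma sum_prod_weights (w : ι → ℝ) (hw : ∑ j, w j = 1) (k : ℕ) :
    ∑ f : Fin k → ι, ∏ a, w (f a) = 1 := by
  induction k with
  | zero => simp
  | succ k ih => simp [sum_fin_succ_fun, Fin.prod_univ_succ, ← Finset.mul_sum, ih, hw]

/-- The expectation of a sum over an i.i.d. sample. -/
lemma sum_prod_weights_mul_sum (w : ι → ℝ) (hw : ∑ j, w j = 1) (h : ι → ℝ) (k : ℕ) :
    ∑ f : Fin k → ι, (∏ a, w (f a)) * ∑ a, h (f a) = k * ∑ j, w j * h j := by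
  induction k with
  | zero => simp
  | succ k ih =>
    have key : ∀ j, ∑ f : Fin k → ι, (w j * ∏ a, w (f a)) * (h j + ∑ a, h (f a))
        = w j * h j + w j * (k * ∑ j, w j * h j) := by
      intro j
      rw [← ih, Finset.mul_sum, ← mul_one (w j * h j), ← sum_prod_weights w hw k, Finset.mul_sum,
        ← Finset.sum_add_distrib]
      exact Finset.sum_congr rfl fun f _ => by ring
    simp only [sum_fin_succ_fun, Fin.prod_univ_succ, Fin.sum_univ_succ, Fin.cons_zero,
      Fin.cons_succ, key, Finset.sum_add_distrib, ← Finset.sum_mul, hw]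
    push_cast
    ring

/-- The expectation of a double sum over an i.i.d. sample. -/
lemma sum_prod_weights_mul_sum_sum (w : ι → ℝ) (hw : ∑ j, w j = 1) (g : ι → ι → ℝ) (k : ℕ) :
    ∑ f : Fin k → ι, (∏ a, w (f a)) * ∑ a, ∑ b, g (f a) (f b)
      = k * (k - 1) * ∑ i, w i * ∑ j, w j * g i j + k * ∑ j, w j * g j j := by
  induction k with
  | zero => simp
  | succ k ih =>
    set Q := ∑ i, w i * ∑ j, w j * g i j with hQ
    have hQ' : ∑ i, w i * ∑ j, w j * g j i = Q := by
      simp only [hQ, Finset.mul_sum]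
      rw [Finset.sum_comm]
      exact Finset.sum_congr rfl fun _ _ => Finset.sum_congr rfl fun _ _ => by ring
    -- The first draw is `j`: it contributes its diagonal term, two cross sums with the other draws,
    -- and the double sum over the remaining `k` draws.
    have key : ∀ j, ∑ f : Fin k → ι, (w j * ∏ a, w (f a)) *
        (g j j + ∑ a, g j (f a) + ∑ a, (g (f a) j + ∑ b, g (f a) (f b)))
        = w j * g j j + k * (w j * ∑ i, w i * g j i) + k * (w j * ∑ i, w i * g i j)
          + w j * (k * (k - 1) * Q + k * ∑ j, w j * g j j) := by
      intro j
      have h1 := sum_prod_weights_mul_sum w hw (g j) k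
      have h2 := sum_prod_weights_mul_sum w hw (fun i => g i j) k
      rw [← ih, mul_left_comm (k : ℝ), mul_left_comm (k : ℝ), ← h1, ← h2, Finset.mul_sum,
        Finset.mul_sum, Finset.mul_sum, ← mul_one (w j * g j j), ← sum_prod_weights w hw k,
        Finset.mul_sum, ← Finset.sum_add_distrib, ← Finset.sum_add_distrib,
        ← Finset.sum_add_distrib]
      refine Finset.sum_congr rfl fun f _ => ?_
      rw [Finset.sum_add_distrib]
      ring
    simp only [sum_fin_succ_fun, Fin.prod_univ_succ, Fin.sum_univ_succ, Fin.cons_zero,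
      Fin.cons_succ]
    simp only [key]
    simp only [Finset.sum_add_distrib, ← Finset.sum_mul, hw, ← Finset.mul_sum, hQ']
    rw [← hQ]
    push_cast
    ring

end Averaging

/-! ### From sparse vectors to all vectors -/

section QuadraticForm

variable {p : ℕ}

lemma quadForm_eq_sum (A : Matrix (Fin p) (Fin p) ℝ) (θ : EuclideanSpace ℝ (Fin p)) :
    quadForm A θ = ∑ j, ∑ l, θ j * θ l * A j l := by
  simp only [quadForm, dotProduct, Matrix.mulVec, Finset.mul_sum]
  exact Finset.sum_congr rfl fun _ _ => Finset.sum_congr rfl fun _ _ => by ring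

lemma quadForm_one (θ : EuclideanSpace ℝ (Fin p)) : quadForm 1 θ = ‖θ‖ ^ 2 := by
  rw [EuclideanSpace.norm_sq_eq]
  simp [quadForm, dotProduct, ← sq]

lemma quadForm_add_smul (A B : Matrix (Fin p) (Fin p) ℝ) (c : ℝ) (θ : EuclideanSpace ℝ (Fin p)) :
    quadForm (A + c • B) θ = quadForm A θ + c * quadForm B θ := by
  simp [quadForm, Matrix.add_mulVec, Matrix.smul_mulVec, dotProduct_add, dotProduct_smul]

/-- The signed standard basis vector `± e_j`. -/
noncomputable def signedSingle (x : Fin p × Bool) : EuclideanSpace ℝ (Fin p) :=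
  EuclideanSpace.single x.1 (if x.2 then 1 else -1)

lemma quadForm_sum_signedSingle (A : Matrix (Fin p) (Fin p) ℝ) {k : ℕ} (f : Fin k → Fin p)
    (σ : Fin p → Bool) :
    quadForm A (∑ a, signedSingle (f a, σ (f a)))
      = ∑ a, ∑ b, (if σ (f a) then 1 else -1) * (if σ (f b) then 1 else -1) * A (f a) (f b) := by
  have h : ∀ l, (∑ a, signedSingle (f a, σ (f a)) : EuclideanSpace ℝ (Fin p)) l
      = ∑ a, if l = f a then (if σ (f a) then (1 : ℝ) else -1) else 0 := by
    intro l
    simp [signedSingle, Pi.single_apply]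
  rw [quadForm_eq_sum]
  simp only [h, Finset.sum_mul_sum]
  simp only [Finset.sum_mul]
  have comm : ∀ F : Fin p → Fin p → Fin k → Fin k → ℝ,
      ∑ j, ∑ l, ∑ a, ∑ b, F j l a b = ∑ a, ∑ b, ∑ j, ∑ l, F j l a b := fun F => calc
    _ = ∑ j, ∑ a, ∑ l, ∑ b, F j l a b := Finset.sum_congr rfl fun j _ => Finset.sum_comm
    _ = ∑ a, ∑ j, ∑ l, ∑ b, F j l a b := Finset.sum_comm
    _ = ∑ a, ∑ j, ∑ b, ∑ l, F j l a b :=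
      Finset.sum_congr rfl fun a _ => Finset.sum_congr rfl fun j _ => Finset.sum_comm
    _ = _ := Finset.sum_congr rfl fun a _ => Finset.sum_comm
  rw [comm]
  refine Finset.sum_congr rfl fun a _ => Finset.sum_congr rfl fun b _ => ?_
  rw [Finset.sum_eq_single (f a), Finset.sum_eq_single (f b)] <;> simp +contextual

/-- If a quadratic form is nonnegative at all sums of `k` signed basis vectors, and its diagonal
is at most `d`, then it is bounded below by a multiple of the squared `ℓ¹` norm. -/
lemma quadForm_ge_neg_l1Norm_sq {k : ℕ} (hk : 2 ≤ k) (G : Matrix (Fin p) (Fin p) ℝ) (d : ℝ)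
    (hd : ∀ j, G j j ≤ d)
    (hG : ∀ x : Fin k → Fin p × Bool, 0 ≤ quadForm G (∑ a, signedSingle (x a)))
    (v : EuclideanSpace ℝ (Fin p)) :
    -(d / (k - 1)) * l1Norm v ^ 2 ≤ quadForm G v := by
  have hk' : (2 : ℝ) ≤ k := by exact_mod_cast hk
  have hN0 : 0 ≤ l1Norm v := Finset.sum_nonneg fun j _ => abs_nonneg (v j)
  rcases hN0.eq_or_lt' with hN | hN
  · have : ∀ j, v j = 0 := by
      intro j
      have := (Finset.sum_eq_zero_iff_of_nonneg fun j _ => abs_nonneg (v j)).1 hN j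
        (Finset.mem_univ _)
      simpa using this
    simp [hN, quadForm_eq_sum, this]
  set N := l1Norm v with hNdef
  set w : Fin p → ℝ := fun j => |v j| / N with hw
  have hw0 : ∀ j, 0 ≤ w j := fun j => by positivity
  have hw1 : ∑ j, w j = 1 := by
    rw [← Finset.sum_div]
    exact div_self hN.ne'
  -- The sign of a drawn basis vector is determined by its index, so sampling indices alone
  -- suffices.
  set σ : Fin p → Bool := fun j => decide (0 ≤ v j) with hσ
  set e : Fin p → ℝ := fun j => if σ j then 1 else -1 with he
  have hv : ∀ j, w j * e j * N = v j := by
    intro j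
    have h1 : |v j| * e j = v j := by
      by_cases h : 0 ≤ v j
      · simp [he, hσ, h, abs_of_nonneg h]
      · simp [he, hσ, h, abs_of_neg (not_le.1 h)]
    calc w j * e j * N = |v j| * e j := by simp only [hw]; field_simp
      _ = v j := h1
  have hee : ∀ j, e j * e j = 1 := by
    intro j
    by_cases h : σ j <;> simp [he, h]
  have hsum := sum_prod_weights_mul_sum_sum w hw1 (fun i j => e i * e j * G i j) k
  have hnn : 0 ≤ ∑ f : Fin k → Fin p,
      (∏ a, w (f a)) * ∑ a, ∑ b, e (f a) * e (f b) * G (f a) (f b) := by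
    refine Finset.sum_nonneg fun f _ => mul_nonneg (Finset.prod_nonneg fun a _ => hw0 _) ?_
    rw [← quadForm_sum_signedSingle]
    exact hG _
  rw [hsum] at hnn
  have hQ : quadForm G v = N ^ 2 * ∑ i, w i * ∑ j, w j * (e i * e j * G i j) := by
    rw [quadForm_eq_sum]
    simp only [Finset.mul_sum]
    refine Finset.sum_congr rfl fun i _ => Finset.sum_congr rfl fun j _ => ?_
    rw [← hv i, ← hv j]
    ring
  have hD : ∑ j, w j * (e j * e j * G j j) ≤ d := by
    calc _ ≤ ∑ j, w j * d := Finset.sum_le_sum fun j _ => by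
            rw [hee, one_mul]
            exact mul_le_mul_of_nonneg_left (hd j) (hw0 j)
      _ = d := by rw [← Finset.sum_mul, hw1, one_mul]
  rw [hQ]
  set T := ∑ i, w i * ∑ j, w j * (e i * e j * G i j)
  -- The averaged inequality is `0 ≤ k(k-1)T + k·(averaged diagonal)`; divide by `k`.
  have hT : -d / (k - 1) ≤ T := by
    rw [div_le_iff₀ (by linarith)]
    have : 0 ≤ (k : ℝ) * ((k - 1) * T + d) := by nlinarith
    have := nonneg_of_mul_nonneg_right this (by linarith)
    linarith
  have := mul_le_mul_of_nonneg_left hT (sq_nonneg N)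
  calc _ = N ^ 2 * (-d / (k - 1)) := by ring
    _ ≤ _ := this

/-- A lower bound for a quadratic form over sums of `k` signed basis vectors, together with an
upper bound for its diagonal, yields a lower bound for the form at every vector. -/
lemma quadForm_ge_of_signedSingle {k : ℕ} (hk : 2 ≤ k) (D : Matrix (Fin p) (Fin p) ℝ) {ξ : ℝ}
    (hξ : 0 ≤ ξ) (hd : ∀ j, D j j ≤ ξ)
    (hD : ∀ x : Fin k → Fin p × Bool,
      -ξ * ‖∑ a, signedSingle (x a)‖ ^ 2 ≤ quadForm D (∑ a, signedSingle (x a)))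
    (v : EuclideanSpace ℝ (Fin p)) :
    -ξ * ‖v‖ ^ 2 - 4 * ξ / k * l1Norm v ^ 2 ≤ quadForm D v := by
  have hk' : (2 : ℝ) ≤ k := by exact_mod_cast hk
  -- Adding `ξ I` turns the hypothesis into nonnegativity at signed sums and raises the diagonal
  -- bound to `2ξ`.
  have h := quadForm_ge_neg_l1Norm_sq hk (D + ξ • (1 : Matrix (Fin p) (Fin p) ℝ)) (2 * ξ)
    (fun j => by simpa using by linarith [hd j]) (fun x => by
      rw [quadForm_add_smul, quadForm_one]
      linarith [hD x]) v
  rw [quadForm_add_smul, quadForm_one] at h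
  have h2 : 2 * ξ / (k - 1) ≤ 4 * ξ / k := by
    rw [div_le_div_iff₀ (by linarith) (by linarith)]
    nlinarith
  nlinarith [mul_le_mul_of_nonneg_right h2 (sq_nonneg (l1Norm v))]

/-- Shifting `A` by `-lambdaMin A` translates the finite spectrum into the nonnegative reals, so the
shifted matrix is positive semidefinite. -/
lemma lambdaMin_mul_norm_sq_le_quadForm {A : Matrix (Fin p) (Fin p) ℝ} (hA : A.IsHermitian)
    (v : EuclideanSpace ℝ (Fin p)) : lambdaMin A * ‖v‖ ^ 2 ≤ quadForm A v := by
  have hB : (A + (-lambdaMin A) • (1 : Matrix (Fin p) (Fin p) ℝ)).PosSemidef := by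
    rw [Matrix.posSemidef_iff_isHermitian_and_spectrum_nonneg]
    refine ⟨hA.add (by simp [Matrix.IsHermitian]), ?_⟩
    intro x hx
    have hx' : x + lambdaMin A ∈ spectrum ℝ A := by
      have := spectrum.add_singleton_eq (R := ℝ) A (-lambdaMin A)
      rw [Algebra.algebraMap_eq_smul_one] at this
      rw [← this] at hx
      obtain ⟨y, hy, z, hz, rfl⟩ := hx
      simp only [Set.mem_singleton_iff] at hz
      subst hz
      simpa using hy
    have hfin : (spectrum ℝ A).Finite := by
      rw [hA.spectrum_real_eq_range_eigenvalues]
      exact Set.finite_range _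
    have : lambdaMin A ≤ x + lambdaMin A := csInf_le hfin.bddBelow hx'
    change 0 ≤ x
    linarith
  have h := hB.dotProduct_mulVec_nonneg (v : Fin p → ℝ)
  have h' : 0 ≤ quadForm (A + (-lambdaMin A) • (1 : Matrix (Fin p) (Fin p) ℝ)) v := by
    simpa [quadForm] using h
  rw [quadForm_add_smul, quadForm_one] at h'
  linarith

end QuadraticForm

/-! ### Restricted eigenvalues on the cone -/

section RestrictedEigenvalue

variable {p : ℕ}

/-- The cone condition costs a factor `1 + 3 = 4` in passing to `S`, squared below; Cauchy–Schwarz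
on `S` gives the factor `k`. -/
lemma l1Norm_sq_le_of_mem_cone {S : Finset (Fin p)} {k : ℕ} (hS : S.card ≤ k)
    {θ : EuclideanSpace ℝ (Fin p)} (hθ : θ ∈ cone S 3) : l1Norm θ ^ 2 ≤ 16 * k * ‖θ‖ ^ 2 := by
  have h1 : l1Norm θ ≤ 4 * ∑ j ∈ S, |θ j| := by
    have : ∑ j ∈ Sᶜ, |θ j| ≤ 3 * ∑ j ∈ S, |θ j| := hθ
    rw [l1Norm, ← Finset.sum_add_sum_compl S]
    linarith
  have h2 : (∑ j ∈ S, |θ j|) ^ 2 ≤ k * ‖θ‖ ^ 2 := by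
    calc (∑ j ∈ S, |θ j|) ^ 2 ≤ S.card * ∑ j ∈ S, |θ j| ^ 2 := sq_sum_le_card_mul_sum_sq
      _ ≤ k * ‖θ‖ ^ 2 := by
        rw [EuclideanSpace.norm_sq_eq]
        refine mul_le_mul (by exact_mod_cast hS) ?_ (by positivity) (by positivity)
        exact Finset.sum_le_sum_of_subset_of_nonneg (Finset.subset_univ _)
          fun _ _ _ => by positivity
  have h0 : 0 ≤ l1Norm θ := Finset.sum_nonneg fun j _ => abs_nonneg (θ j)
  nlinarith [pow_le_pow_left₀ h0 h1 2]

/-- On the cone the total loss is `(27 + 54·16) Ξ = 891 Ξ`, and `1782 = 2·891`. The sign of `Ξ` is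
not assumed; for `Ξ ≤ 0` both error terms help. -/
lemma RSC.restrictedEigenvalue {A : Matrix (Fin p) (Fin p) ℝ} {lam Ξ : ℝ} {k : ℕ} (hk : 1 ≤ k)
    (h : RSC A lam Ξ k) (hlam : 0 < lam) (hΞ : 1782 * Ξ ≤ lam) :
    RestrictedEigenvalue A k 3 (lam / 2) := by
  refine ⟨by positivity, fun S hS θ hθ hθ0 => ?_⟩
  have hk' : (0 : ℝ) < k := by exact_mod_cast hk
  have hn : 0 < ‖θ‖ ^ 2 := by positivity
  have hdot : θ ⬝ᵥ θ = ‖θ‖ ^ 2 := by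
    rw [EuclideanSpace.norm_sq_eq]
    simp [dotProduct, ← sq]
  rw [ge_iff_le, hdot, le_div_iff₀ hn]
  have h1 := h θ
  have h2 := l1Norm_sq_le_of_mem_cone hS hθ
  rcases le_total 0 Ξ with h0 | h0
  · have h3 : 54 * Ξ / k * l1Norm θ ^ 2 ≤ 864 * Ξ * ‖θ‖ ^ 2 := by
      calc 54 * Ξ / k * l1Norm θ ^ 2 ≤ 54 * Ξ / k * (16 * k * ‖θ‖ ^ 2) := by gcongr
        _ = _ := by field_simp; ring
    nlinarith
  · have h3 : 54 * Ξ / k * l1Norm θ ^ 2 ≤ 0 :=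
      mul_nonpos_of_nonpos_of_nonneg (div_nonpos_of_nonpos_of_nonneg (by linarith) hk'.le)
        (sq_nonneg _)
    nlinarith

end RestrictedEigenvalue

/-! ### Counting multisets -/

section Counting

/-- The count is at most `(2p+k)^k / k!`; then `2p + k ≤ 3rk`, and `k^k ≤ e^k k!` with `e ≤ 4` gives
`12 = 3·4`. -/
lemma card_sym_le {p k : ℕ} (hk : 1 ≤ k) {r : ℝ} (hr : 3 ≤ r) (hp : p / (k : ℝ) ≤ r) :
    (Fintype.card (Sym (Fin p × Bool) k) : ℝ) ≤ (12 * r) ^ k := by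
  have hk' : (0 : ℝ) < k := by exact_mod_cast hk
  rw [Sym.card_sym_eq_choose]
  have hc : Fintype.card (Fin p × Bool) = p * 2 := by simp
  rw [hc]
  have hfac : (k : ℝ) ^ k ≤ Real.exp k * k.factorial := by
    have := Real.pow_div_factorial_le_exp (k : ℝ) hk'.le k
    rwa [div_le_iff₀ (by positivity)] at this
  calc (((p * 2 + k - 1).choose k : ℕ) : ℝ) ≤ ((p * 2 + k - 1 : ℕ) : ℝ) ^ k / k.factorial :=
        Nat.choose_le_pow_div _ _
    _ ≤ (2 * p + k) ^ k / k.factorial := by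
        gcongr
        have : p * 2 + k - 1 ≤ 2 * p + k := by omega
        exact_mod_cast this
    _ ≤ (12 * r) ^ k := by
        rw [div_le_iff₀ (by positivity)]
        have h1 : (2 * (p : ℝ) + k) ≤ 3 * r * k := by
          rw [div_le_iff₀ hk'] at hp
          nlinarith
        calc (2 * (p : ℝ) + k) ^ k ≤ (3 * r * k) ^ k := by gcongr
          _ = (3 * r) ^ k * (k : ℝ) ^ k := by rw [mul_pow]
          _ ≤ (3 * r) ^ k * (Real.exp k * k.factorial) := by gcongr
          _ ≤ (3 * r) ^ k * (4 ^ k * k.factorial) := by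
            gcongr
            rw [← Real.exp_one_pow]
            gcongr
            linarith [Real.exp_one_lt_d9]
          _ = (12 * r) ^ k * k.factorial := by
            rw [← mul_assoc, ← mul_pow]
            ring_nf

end Counting

/-! ### Bernstein's inequality and the lower tail -/

section Bernstein

variable {Ω : Type*} [MeasurableSpace Ω] {μ : Measure Ω} [IsProbabilityMeasure μ]
  {ι : Type*} [Fintype ι]

/-- No lower bound on `x` is required, which is why an upper bound on the summands suffices for
Bernstein's inequality. -/
lemma exp_le_one_add_add_sq {x : ℝ} (hx : x ≤ 1) : Real.exp x ≤ 1 + x + x ^ 2 := by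
  rcases le_total (-1) x with h | h
  · have := abs_le.1 (Real.abs_exp_sub_one_sub_id_le (abs_le.2 ⟨h, hx⟩))
    linarith [this.2]
  · have := Real.exp_le_one_iff.2 (show x ≤ 0 by linarith)
    nlinarith

lemma mgf_le_exp_sq_mul_variance {W : Ω → ℝ} (hW : MemLp W 2 μ) (h0 : ∫ ω, W ω ∂μ = 0)
    {t M : ℝ} (ht : 0 ≤ t) (htM : t * M ≤ 1) (hM : ∀ ω, W ω ≤ M) :
    mgf W μ t ≤ Real.exp (t ^ 2 * variance W μ) := by
  have hi : Integrable W μ := hW.integrable one_le_two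
  have hi2 : Integrable (fun ω => W ω ^ 2) μ := hW.integrable_sq
  have hi1 : Integrable (fun ω => 1 + t * W ω) μ := (integrable_const _).add (hi.const_mul t)
  rw [variance_of_integral_eq_zero hi.aemeasurable h0]
  calc mgf W μ t = ∫ ω, Real.exp (t * W ω) ∂μ := rfl
    _ ≤ ∫ ω, (1 + t * W ω + t ^ 2 * W ω ^ 2) ∂μ := by
        refine integral_mono
          (integrable_exp_mul_of_le t M ht hi.aemeasurable (Filter.Eventually.of_forall hM))
          (hi1.add (hi2.const_mul _)) fun ω => ?_
        refine (exp_le_one_add_add_sq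
          ((mul_le_mul_of_nonneg_left (hM ω) ht).trans htM)).trans_eq ?_
        ring
    _ = 1 + t ^ 2 * ∫ ω, W ω ^ 2 ∂μ := by
        rw [integral_add hi1 (hi2.const_mul _),
          integral_add (integrable_const _) (hi.const_mul t), integral_const_mul,
          integral_const_mul, h0]
        simp
    _ ≤ _ := by linarith [Real.add_one_le_exp (t ^ 2 * ∫ ω, W ω ^ 2 ∂μ)]

/-- **Bernstein's inequality**, one-sided form, for sums of independent centred random variables
which are bounded above. -/
lemma measureReal_sum_ge_le_exp_neg {W : ι → Ω → ℝ} (hind : iIndepFun W μ)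
    (hm : ∀ i, Measurable (W i)) (hW : ∀ i, MemLp (W i) 2 μ) (h0 : ∀ i, ∫ ω, W i ω ∂μ = 0)
    {M v s : ℝ} (hM : 0 < M) (hs : 0 ≤ s) (hWM : ∀ i ω, W i ω ≤ M)
    (hv : ∑ i, variance (W i) μ ≤ v) :
    μ.real {ω | 2 * √(v * s) + 2 * M * s ≤ ∑ i, W i ω} ≤ Real.exp (-s) := by
  have hv0 : 0 ≤ v := (Finset.sum_nonneg fun i _ => variance_nonneg _ _).trans hv
  have chernoff : ∀ t r : ℝ, 0 ≤ t → t * M ≤ 1 → r ≤ 2 * √(v * s) + 2 * M * s →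
      -t * r + t ^ 2 * v ≤ -s →
      μ.real {ω | 2 * √(v * s) + 2 * M * s ≤ ∑ i, W i ω} ≤ Real.exp (-s) := by
    intro t r ht htM hr hle
    have hint : Integrable (fun ω => Real.exp (t * (∑ i, W i) ω)) μ :=
      hind.integrable_exp_mul_sum hm fun i _ =>
        integrable_exp_mul_of_le t M ht (hm i).aemeasurable
          (Filter.Eventually.of_forall (hWM i))
    calc μ.real {ω | 2 * √(v * s) + 2 * M * s ≤ ∑ i, W i ω}
        ≤ μ.real {ω | r ≤ (∑ i, W i) ω} := by
          refine measureReal_mono fun ω hω => ?_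
          simp only [Set.mem_ofPred_eq, Finset.sum_apply] at hω ⊢
          exact hr.trans hω
      _ ≤ Real.exp (-t * r) * mgf (∑ i, W i) μ t := measure_ge_le_exp_mul_mgf r ht hint
      _ ≤ Real.exp (-t * r) * Real.exp (t ^ 2 * v) := by
          gcongr
          rw [hind.mgf_sum hm]
          calc ∏ i, mgf (W i) μ t ≤ ∏ i, Real.exp (t ^ 2 * variance (W i) μ) :=
                Finset.prod_le_prod (fun i _ => mgf_nonneg)
                  fun i _ => mgf_le_exp_sq_mul_variance (hW i) (h0 i) ht htM (hWM i)
            _ = Real.exp (t ^ 2 * ∑ i, variance (W i) μ) := by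
                rw [← Real.exp_sum, Finset.mul_sum]
            _ ≤ _ := by gcongr
      _ ≤ Real.exp (-s) := by
          rw [← Real.exp_add]
          gcongr
  -- The ideal parameter `t = √(s/v)` is admissible only if `t M ≤ 1`; otherwise `t = 1/M` is used.
  -- In each regime one of the two terms of the threshold suffices as `r`, giving exponent at most
  -- `-2s + s`.
  rcases le_or_gt v (M ^ 2 * s) with h | h
  · refine chernoff (1 / M) (2 * M * s) (by positivity) (by field_simp; rfl)
      (by linarith [Real.sqrt_nonneg (v * s)]) ?_
    have : (1 / M) ^ 2 * v ≤ s := by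
      rw [one_div, inv_pow, inv_mul_le_iff₀ (by positivity)]
      exact h
    have h2 : -(1 / M) * (2 * M * s) = -2 * s := by field_simp
    linarith
  · have hvpos : 0 < v := lt_of_le_of_lt (by positivity) h
    refine chernoff (√(v * s) / v) (2 * √(v * s)) (by positivity) ?_
      (by nlinarith [mul_nonneg hM.le hs]) ?_
    · rw [div_mul_eq_mul_div, div_le_one hvpos]
      refine abs_le_of_sq_le_sq' ?_ hvpos.le |>.2
      rw [mul_pow, Real.sq_sqrt (by positivity)]
      nlinarith
    · have hsq : √(v * s) * √(v * s) = v * s := Real.mul_self_sqrt (by positivity)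
      have e1 : √(v * s) / v * (2 * √(v * s)) = 2 * s := by
        rw [div_mul_eq_mul_div, mul_left_comm, hsq]
        field_simp
      have e2 : (√(v * s) / v) ^ 2 * v = s := by
        rw [div_pow, sq (√(v * s)), hsq]
        field_simp
      linarith

/-- Lower tail of a sum of independent nonnegative random variables. -/
lemma measureReal_sum_le_le_exp_neg {Y : ι → Ω → ℝ} (hind : iIndepFun Y μ)
    (hm : ∀ i, Measurable (Y i)) (hY : ∀ i, MemLp (Y i) 2 μ) (hY0 : ∀ i ω, 0 ≤ Y i ω)
    {M v s : ℝ} (hM : 0 < M) (hs : 0 ≤ s) (hYM : ∀ i, ∫ ω, Y i ω ∂μ ≤ M)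
    (hv : ∑ i, variance (Y i) μ ≤ v) :
    μ.real {ω | ∑ i, Y i ω ≤ ∑ i, ∫ ω, Y i ω ∂μ - (2 * √(v * s) + 2 * M * s)}
      ≤ Real.exp (-s) := by
  -- Nonnegativity of `Y` bounds `E Y - Y` above by `E Y ≤ M`, so no truncation is needed.
  have key := measureReal_sum_ge_le_exp_neg (W := fun i ω => ∫ ω, Y i ω ∂μ - Y i ω) (μ := μ)
    (hind.comp (fun i y => ∫ ω, Y i ω ∂μ - y) fun i => measurable_id.const_sub _)
    (fun i => (hm i).const_sub _) (fun i => (memLp_const _).sub (hY i))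
    (fun i => by
      rw [integral_sub (integrable_const _) ((hY i).integrable one_le_two)]
      simp) hM hs
    (fun i ω => by linarith [hYM i, hY0 i ω])
    ((Finset.sum_congr rfl fun i _ =>
      variance_const_sub (hm i).aestronglyMeasurable _).trans_le hv)
  refine (measureReal_mono fun ω hω => ?_).trans key
  simp only [Set.mem_ofPred_eq, Finset.sum_sub_distrib] at hω ⊢
  linarith

/-- Truncation is 1-Lipschitz, and variance is at most the second moment about any point, here `min
m B`. -/
lemma variance_min_le {Y : Ω → ℝ} (hm : Measurable Y) (hY : MemLp Y 2 μ) (B : ℝ) :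
    variance (fun ω => min (Y ω) B) μ ≤ variance Y μ := by
  set m := ∫ ω, Y ω ∂μ with hmdef
  have hmin : Measurable fun ω => min (Y ω) B := hm.min measurable_const
  rw [← variance_sub_const hmin.aestronglyMeasurable (min m B),
    variance_eq_integral hm.aemeasurable]
  refine (variance_le_expectation_sq
    (hmin.sub_const _).aestronglyMeasurable).trans ?_
  refine integral_mono_of_nonneg (Filter.Eventually.of_forall fun ω => sq_nonneg _)
    (hY.sub (memLp_const m)).integrable_sq (Filter.Eventually.of_forall fun ω => ?_)
  refine sq_le_sq.2 ?_
  have := abs_min_sub_min_le_max (Y ω) B m B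
  simpa using this

end Bernstein

/-! ### Upper tail by truncation -/

section UpperTail

variable {Ω : Type*} [MeasurableSpace Ω] {μ : Measure Ω} [IsProbabilityMeasure μ] {n : ℕ}

lemma sum_rpow_le {ι : Type*} (s : Finset ι) (a : ι → ℝ) (ha : ∀ i, 0 ≤ a i) {β : ℝ} (hβ : 0 < β)
    (hβ1 : β ≤ 1) : (∑ i ∈ s, a i) ^ β ≤ ∑ i ∈ s, a i ^ β :=
  Finset.le_sum_of_subadditive_on_pred (fun x => x ^ β) (fun x => 0 ≤ x)
    (by simp [Real.zero_rpow hβ.ne'])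
    (fun _ _ hx hy => Real.rpow_add_le_add_rpow hx hy hβ.le hβ1)
    (fun _ _ hx hy => add_nonneg hx hy) a fun i _ => ha i

/-- The excess over the truncation level `L (2 log (2n))^{1/β}` of a sum of independent
`β`-sub-Weibull variables has a sub-Weibull tail, uniformly in `n`. -/
lemma measureReal_sum_excess_ge_le (hn : 1 ≤ n) {Y : Fin n → Ω → ℝ} (hind : iIndepFun Y μ)
    (hm : ∀ i, Measurable (Y i)) (hY0 : ∀ i ω, 0 ≤ Y i ω) {β L s : ℝ} (hβ : 0 < β) (hβ1 : β ≤ 1)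
    (hL : 0 < L) (hs : 0 ≤ s) (hint : ∀ i, Integrable (fun ω => Real.exp ((Y i ω / L) ^ β)) μ)
    (hexp : ∀ i, ∫ ω, Real.exp ((Y i ω / L) ^ β) ∂μ ≤ 2) :
    μ.real {ω | L * (2 * (s + 1)) ^ (1 / β) ≤
      ∑ i, max (Y i ω - L * (2 * Real.log (2 * n)) ^ (1 / β)) 0} ≤ Real.exp (-s) := by
  have hn' : (1 : ℝ) ≤ n := by exact_mod_cast hn
  have hlog : 0 < Real.log (2 * n) := Real.log_pos (by linarith)
  set B := L * (2 * Real.log (2 * n)) ^ (1 / β) with hB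
  have hB0 : 0 < B := by positivity
  set g : ℝ → ℝ := fun y => (max (y - B) 0 / L) ^ β with hg
  have hgm : Measurable g := by fun_prop
  have hg0 : ∀ y, 0 ≤ g y := fun y => by positivity
  -- Above the truncation level `(y/L)^β ≥ 2 log(2n)`, so halving the exponent gains a factor
  -- `1/(2n)`. Each exponential moment is then at most `1 + 1/n`, and the product of `n` of them at
  -- most `e`.
  have hpt : ∀ y, 0 ≤ y →
      Real.exp (1 / 2 * g y) ≤ 1 + 1 / (2 * n) * Real.exp ((y / L) ^ β) := by
    intro y hy
    rcases le_or_gt y B with h | h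
    · have : g y = 0 := by
        simp [hg, max_eq_right (sub_nonpos.2 h), Real.zero_rpow hβ.ne']
      rw [this, mul_zero, Real.exp_zero]
      exact le_add_of_nonneg_right (by positivity)
    · have h1 : g y ≤ (y / L) ^ β := by
        refine Real.rpow_le_rpow (by positivity) ?_ hβ.le
        gcongr
        exact max_le (by linarith) hy
      have h2 : 2 * Real.log (2 * n) ≤ (y / L) ^ β := by
        have : (2 * Real.log (2 * n)) ^ (1 / β) ≤ y / L := by
          rw [le_div_iff₀ hL, mul_comm]
          exact h.le
        calc 2 * Real.log (2 * n) = ((2 * Real.log (2 * n)) ^ (1 / β)) ^ β := by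
              rw [← Real.rpow_mul (by positivity), one_div_mul_cancel hβ.ne', Real.rpow_one]
          _ ≤ _ := Real.rpow_le_rpow (by positivity) this hβ.le
      calc Real.exp (1 / 2 * g y)
          ≤ Real.exp (-Real.log (2 * n) + (y / L) ^ β) := by
            gcongr
            linarith
        _ = 1 / (2 * n) * Real.exp ((y / L) ^ β) := by
            rw [Real.exp_add, Real.exp_neg, Real.exp_log (by positivity), one_div]
        _ ≤ _ := by linarith
  have hdom : ∀ i, Integrable (fun ω => 1 + 1 / (2 * n) * Real.exp ((Y i ω / L) ^ β)) μ :=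
    fun i => (integrable_const _).add ((hint i).const_mul _)
  have hTint : ∀ i, Integrable (fun ω => Real.exp (1 / 2 * (g ∘ Y i) ω)) μ := by
    intro i
    have hgi : Measurable (g ∘ Y i) := hgm.comp (hm i)
    refine (hdom i).mono' (hgi.const_mul _).exp.aestronglyMeasurable (Filter.Eventually.of_forall fun ω => ?_)
    rw [Real.norm_eq_abs, Real.abs_exp]
    exact hpt _ (hY0 i ω)
  have hmgf : ∀ i, mgf (g ∘ Y i) μ (1 / 2) ≤ Real.exp (1 / n) := by
    intro i
    calc mgf (g ∘ Y i) μ (1 / 2)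
        ≤ ∫ ω, (1 + 1 / (2 * n) * Real.exp ((Y i ω / L) ^ β)) ∂μ :=
          integral_mono (hTint i) (hdom i) fun ω => hpt _ (hY0 i ω)
      _ = 1 + 1 / (2 * n) * ∫ ω, Real.exp ((Y i ω / L) ^ β) ∂μ := by
          rw [integral_add (integrable_const _) ((hint i).const_mul _), integral_const_mul]
          simp
      _ ≤ 1 + 1 / (2 * n) * 2 := by
          gcongr
          exact hexp i
      _ = 1 / n + 1 := by field_simp; ring
      _ ≤ _ := Real.add_one_le_exp _
  have hindT : iIndepFun (fun i => g ∘ Y i) μ := hind.comp (fun _ => g) fun _ => hgm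
  have hmT : ∀ i, Measurable (g ∘ Y i) := fun i => hgm.comp (hm i)
  calc μ.real {ω | L * (2 * (s + 1)) ^ (1 / β) ≤ ∑ i, max (Y i ω - B) 0}
      ≤ μ.real {ω | 2 * (s + 1) ≤ (∑ i, g ∘ Y i) ω} := by
        refine measureReal_mono fun ω hω => ?_
        simp only [Set.mem_ofPred_eq, Finset.sum_apply, Function.comp_apply] at hω ⊢
        -- Subadditivity of `x ^ β` for `β ≤ 1` passes from the sum of excesses to the sum of their
        -- powers. The `+ 1` in the threshold pays for the factor `e`.
        calc 2 * (s + 1) = ((2 * (s + 1)) ^ (1 / β)) ^ β := by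
              rw [← Real.rpow_mul (by positivity), one_div_mul_cancel hβ.ne', Real.rpow_one]
          _ ≤ (∑ i, max (Y i ω - B) 0 / L) ^ β := by
              refine Real.rpow_le_rpow (by positivity) ?_ hβ.le
              rw [← Finset.sum_div, le_div_iff₀ hL, mul_comm]
              exact hω
          _ ≤ _ := sum_rpow_le _ _ (fun i => by positivity) hβ hβ1
    _ ≤ Real.exp (-(1 / 2) * (2 * (s + 1))) * mgf (∑ i, g ∘ Y i) μ (1 / 2) :=
        measure_ge_le_exp_mul_mgf _ (by norm_num)
          (hindT.integrable_exp_mul_sum hmT fun i _ => hTint i)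
    _ ≤ Real.exp (-(1 / 2) * (2 * (s + 1))) * Real.exp 1 := by
        gcongr
        rw [hindT.mgf_sum hmT]
        calc ∏ i, mgf (g ∘ Y i) μ (1 / 2) ≤ ∏ _i : Fin n, Real.exp (1 / n) :=
              Finset.prod_le_prod (fun i _ => mgf_nonneg) fun i _ => hmgf i
          _ = Real.exp 1 := by
              rw [Finset.prod_const, Finset.card_univ, Fintype.card_fin, ← Real.exp_nat_mul]
              congr 1
              field_simp
    _ = Real.exp (-s) := by
        rw [← Real.exp_add]
        congr 1
        ring

/-- Upper tail of a sum of independent nonnegative `β`-sub-Weibull variables, `0 < β ≤ 1`. -/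
lemma measureReal_sum_ge_le_two_mul_exp_neg (hn : 1 ≤ n) {Y : Fin n → Ω → ℝ}
    (hind : iIndepFun Y μ) (hm : ∀ i, Measurable (Y i)) (hY : ∀ i, MemLp (Y i) 2 μ)
    (hY0 : ∀ i ω, 0 ≤ Y i ω) {β L v s : ℝ} (hβ : 0 < β) (hβ1 : β ≤ 1) (hL : 0 < L) (hs : 0 ≤ s)
    (hint : ∀ i, Integrable (fun ω => Real.exp ((Y i ω / L) ^ β)) μ)
    (hexp : ∀ i, ∫ ω, Real.exp ((Y i ω / L) ^ β) ∂μ ≤ 2)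
    (hv : ∑ i, variance (Y i) μ ≤ v) :
    μ.real {ω | ∑ i, ∫ ω, Y i ω ∂μ + (2 * √(v * s)
        + 2 * (L * (2 * Real.log (2 * n)) ^ (1 / β)) * s + L * (2 * (s + 1)) ^ (1 / β))
          ≤ ∑ i, Y i ω} ≤ 2 * Real.exp (-s) := by
  have hn' : (1 : ℝ) ≤ n := by exact_mod_cast hn
  have hlog : 0 < Real.log (2 * n) := Real.log_pos (by linarith)
  have hrem := measureReal_sum_excess_ge_le hn hind hm hY0 hβ hβ1 hL hs hint hexp
  set B := L * (2 * Real.log (2 * n)) ^ (1 / β) with hB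
  have hB0 : 0 < B := by positivity
  have hminm : ∀ i, Measurable fun ω => min (Y i ω) B := fun i => (hm i).min measurable_const
  have hmin0 : ∀ i ω, 0 ≤ min (Y i ω) B := fun i ω => le_min (hY0 i ω) hB0.le
  have hminL : ∀ i, MemLp (fun ω => min (Y i ω) B) 2 μ := fun i =>
    (hY i).mono (hminm i).aestronglyMeasurable (Filter.Eventually.of_forall fun ω => by
      rw [Real.norm_of_nonneg (hmin0 i ω), Real.norm_of_nonneg (hY0 i ω)]
      exact min_le_left _ _)
  have hbern := measureReal_sum_ge_le_exp_neg (μ := μ)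
    (W := fun i ω => min (Y i ω) B - ∫ ω, min (Y i ω) B ∂μ)
    (hind.comp (fun i y => min y B - ∫ ω, min (Y i ω) B ∂μ) fun i =>
      (measurable_id.min measurable_const).sub_const _)
    (fun i => (hminm i).sub_const _) (fun i => (hminL i).sub (memLp_const _))
    (fun i => by
      rw [integral_sub ((hminL i).integrable one_le_two) (integrable_const _)]
      simp) hB0 hs
    (fun i ω => by
      have h1 : 0 ≤ ∫ ω, min (Y i ω) B ∂μ := integral_nonneg (hmin0 i)
      have h2 : min (Y i ω) B ≤ B := min_le_right _ _
      linarith)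
    ((Finset.sum_le_sum fun i _ =>
      (variance_sub_const (hminm i).aestronglyMeasurable _).trans_le
        (variance_min_le (hm i) (hY i) B)).trans hv)
  refine (measureReal_mono (fun ω hω => ?_)).trans
    ((measureReal_union_le _ _).trans ((add_le_add hbern hrem).trans_eq (two_mul _).symm))
  simp only [Set.mem_union, Set.mem_ofPred_eq, Finset.sum_sub_distrib] at hω ⊢
  -- Split `Y = min Y B + (Y - B)₊`: if neither part is large, the sum cannot be, since truncation
  -- only lowers the mean.
  by_contra! hcon
  have h1 : ∑ i, ∫ ω, min (Y i ω) B ∂μ ≤ ∑ i, ∫ ω, Y i ω ∂μ :=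
    Finset.sum_le_sum fun i _ => integral_mono ((hminL i).integrable one_le_two)
      ((hY i).integrable one_le_two) fun ω => min_le_left _ _
  have h2 : ∑ i, Y i ω = ∑ i, min (Y i ω) B + ∑ i, max (Y i ω - B) 0 := by
    rw [← Finset.sum_add_distrib]
    refine Finset.sum_congr rfl fun i _ => ?_
    rcases le_total (Y i ω) B with h | h <;> simp [h]
  linarith [hcon.1, hcon.2]

end UpperTail

/-! ### Moments from Orlicz norms -/

section Orlicz

variable {Ω : Type*} [MeasurableSpace Ω] {μ : Measure Ω}

/-- Strict inequality yields an admissible scale below `η`, and `psi α` is monotone; attainment of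
the infimum is not needed. -/
lemma lintegral_psi_le_one_of_orliczNorm_lt {α : ℝ} (hα : 0 < α) {f : Ω → ℝ} {η : ℝ}
    (h : orliczNorm (psi α) f μ < ENNReal.ofReal η) :
    ∫⁻ ω, ENNReal.ofReal (psi α (|f ω| / η)) ∂μ ≤ 1 := by
  simp only [orliczNorm, iInf_lt_iff] at h
  obtain ⟨η', h0, hle, hlt⟩ := h
  have hlt' : η' < η := (ENNReal.ofReal_lt_ofReal_iff_of_nonneg h0.le).1 hlt
  refine (lintegral_mono fun ω => ?_).trans hle
  refine ENNReal.ofReal_le_ofReal ?_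
  have hη : 0 < η := h0.trans hlt'
  unfold psi
  gcongr

variable [IsProbabilityMeasure μ]

lemma integrable_exp_of_orliczNorm_lt {α : ℝ} (hα : 0 < α) {f : Ω → ℝ} (hf : Measurable f) {η : ℝ}
    (hη : 0 < η) (h : orliczNorm (psi α) f μ < ENNReal.ofReal η) :
    Integrable (fun ω => Real.exp ((|f ω| / η) ^ α)) μ ∧
      ∫ ω, Real.exp ((|f ω| / η) ^ α) ∂μ ≤ 2 := by
  have hl := lintegral_psi_le_one_of_orliczNorm_lt hα h
  have hnn : ∀ ω, 0 ≤ psi α (|f ω| / η) := fun ω => by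
    unfold psi
    have : 0 ≤ (|f ω| / η) ^ α := by positivity
    linarith [Real.one_le_exp this]
  have hmeas : Measurable fun ω => psi α (|f ω| / η) := by
    unfold psi
    fun_prop
  have hi : Integrable (fun ω => psi α (|f ω| / η)) μ := by
    refine ⟨hmeas.aestronglyMeasurable, ?_⟩
    rw [hasFiniteIntegral_iff_ofReal (Filter.Eventually.of_forall hnn)]
    exact hl.trans_lt ENNReal.one_lt_top
  have hle : ∫ ω, psi α (|f ω| / η) ∂μ ≤ 1 := by
    rw [← ENNReal.ofReal_le_one,
      ofReal_integral_eq_lintegral_ofReal hi (Filter.Eventually.of_forall hnn)]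
    exact hl
  have he : (fun ω => Real.exp ((|f ω| / η) ^ α)) = fun ω => psi α (|f ω| / η) + 1 := by
    funext ω
    simp [psi]
  rw [he]
  refine ⟨hi.add (integrable_const _), ?_⟩
  rw [integral_add hi (integrable_const _)]
  simp
  linarith

/-- With `y = x ^ α`, `x ^ m = y ^ (m/α) ≤ 1 + y ^ N` for `N = ⌈m/α⌉`, and `y ^ N ≤ N! e^y`. -/
lemma exists_pow_le_mul_exp_rpow {α : ℝ} (hα : 0 < α) (m : ℕ) :
    ∃ c : ℝ, 0 < c ∧ ∀ x : ℝ, 0 ≤ x → x ^ m ≤ c * Real.exp (x ^ α) := by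
  set N := ⌈m / α⌉₊ with hN
  refine ⟨1 + N.factorial, by positivity, fun x hx => ?_⟩
  set y := x ^ α with hy
  have hy0 : 0 ≤ y := by positivity
  have h1 : x ^ m = y ^ (m / α : ℝ) := by
    rw [hy, ← Real.rpow_mul hx, mul_div_cancel₀ _ hα.ne', Real.rpow_natCast]
  have h2 : y ^ (m / α : ℝ) ≤ 1 + y ^ N := by
    rcases le_total y 1 with h | h
    · have : y ^ (m / α : ℝ) ≤ 1 := Real.rpow_le_one hy0 h (by positivity)
      linarith [pow_nonneg hy0 N]
    · have : y ^ (m / α : ℝ) ≤ y ^ (N : ℝ) :=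
        Real.rpow_le_rpow_of_exponent_le h (Nat.le_ceil _)
      rw [Real.rpow_natCast] at this
      linarith
  have h3 : y ^ N ≤ N.factorial * Real.exp y := by
    have := Real.pow_div_factorial_le_exp y hy0 N
    rwa [div_le_iff₀ (by positivity), mul_comm] at this
  rw [h1]
  linarith [Real.one_le_exp hy0]

lemma integrable_abs_pow_of_orliczNorm_lt {α : ℝ} (hα : 0 < α) {f : Ω → ℝ} (hf : Measurable f)
    {η : ℝ} (hη : 0 < η) (h : orliczNorm (psi α) f μ < ENNReal.ofReal η) {m : ℕ} {c : ℝ}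
    (hc : ∀ x : ℝ, 0 ≤ x → x ^ m ≤ c * Real.exp (x ^ α)) (hc0 : 0 ≤ c) :
    Integrable (fun ω => |f ω| ^ m) μ ∧ ∫ ω, |f ω| ^ m ∂μ ≤ 2 * c * η ^ m := by
  obtain ⟨hi, hle⟩ := integrable_exp_of_orliczNorm_lt hα hf hη h
  have hpt : ∀ ω, |f ω| ^ m ≤ η ^ m * c * Real.exp ((|f ω| / η) ^ α) := by
    intro ω
    have := hc (|f ω| / η) (by positivity)
    rw [div_pow, div_le_iff₀ (by positivity)] at this
    linarith
  have hint : Integrable (fun ω => |f ω| ^ m) μ := by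
    refine (hi.const_mul (η ^ m * c)).mono' (by fun_prop) (Filter.Eventually.of_forall fun ω => ?_)
    rw [Real.norm_of_nonneg (by positivity)]
    exact hpt ω
  refine ⟨hint, ?_⟩
  calc ∫ ω, |f ω| ^ m ∂μ ≤ ∫ ω, η ^ m * c * Real.exp ((|f ω| / η) ^ α) ∂μ :=
        integral_mono hint (hi.const_mul _) hpt
    _ = η ^ m * c * ∫ ω, Real.exp ((|f ω| / η) ^ α) ∂μ := integral_const_mul _ _
    _ ≤ η ^ m * c * 2 := by gcongr
    _ = _ := by ring

end Orlicz

/-! ### Gram matrices and the finite set of signed sums -/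

section Gram

variable {Ω : Type*} {n p : ℕ}

lemma quadForm_sampleGram (X : Fin n → Ω → EuclideanSpace ℝ (Fin p)) (ω : Ω)
    (θ : EuclideanSpace ℝ (Fin p)) :
    quadForm (sampleGram X ω) θ = (1 / (n : ℝ)) * ∑ i, (X i ω ⬝ᵥ θ) ^ 2 := by
  simp only [quadForm_eq_sum, sampleGram, Matrix.of_apply, dotProduct, sq, Finset.sum_mul_sum]
  rw [Finset.sum_comm, Finset.mul_sum, Finset.sum_comm]
  simp only [Finset.mul_sum]
  rw [Finset.sum_congr rfl fun j _ => Finset.sum_comm, Finset.sum_comm]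
  refine Finset.sum_congr rfl fun i _ => Finset.sum_congr rfl fun j _ =>
    Finset.sum_congr rfl fun l _ => ?_
  ring

variable [MeasurableSpace Ω] {μ : Measure Ω}

lemma quadForm_popGram (X : Fin n → Ω → EuclideanSpace ℝ (Fin p))
    (hX : ∀ i j l, Integrable (fun ω => X i ω j * X i ω l) μ) (θ : EuclideanSpace ℝ (Fin p)) :
    quadForm (popGram X μ) θ = (1 / (n : ℝ)) * ∑ i, ∫ ω, (X i ω ⬝ᵥ θ) ^ 2 ∂μ := by
  have h : ∀ i, ∫ ω, (X i ω ⬝ᵥ θ) ^ 2 ∂μ = ∑ j, ∑ l, θ j * θ l * ∫ ω, X i ω j * X i ω l ∂μ := by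
    intro i
    have e : ∀ ω, (X i ω ⬝ᵥ θ) ^ 2 = ∑ j, ∑ l, θ j * θ l * (X i ω j * X i ω l) := by
      intro ω
      simp only [dotProduct, sq, Finset.sum_mul_sum]
      exact Finset.sum_congr rfl fun _ _ => Finset.sum_congr rfl fun _ _ => by ring
    simp only [e]
    rw [integral_finsetSum _ fun j _ => integrable_finsetSum _ fun l _ => (hX i j l).const_mul _]
    refine Finset.sum_congr rfl fun j _ => ?_
    rw [integral_finsetSum _ fun l _ => (hX i j l).const_mul _]
    simp only [integral_const_mul]
  simp only [h, quadForm_eq_sum, popGram, Matrix.of_apply, Finset.mul_sum]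
  refine Eq.symm (Finset.sum_comm.trans (Finset.sum_congr rfl fun j _ =>
    Finset.sum_comm.trans (Finset.sum_congr rfl fun l _ => Finset.sum_congr rfl fun i _ => ?_)))
  ring

lemma isHermitian_popGram (X : Fin n → Ω → EuclideanSpace ℝ (Fin p)) :
    (popGram X μ).IsHermitian := by
  ext j l
  simp [popGram, Matrix.conjTranspose_apply, mul_comm]

lemma quadForm_smul (A : Matrix (Fin p) (Fin p) ℝ) (c : ℝ) (θ : EuclideanSpace ℝ (Fin p)) :
    quadForm A (c • θ) = c ^ 2 * quadForm A θ := by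
  simp only [quadForm_eq_sum, PiLp.smul_apply, smul_eq_mul, Finset.mul_sum]
  exact Finset.sum_congr rfl fun _ _ => Finset.sum_congr rfl fun _ _ => by ring

lemma quadForm_sub (A B : Matrix (Fin p) (Fin p) ℝ) (θ : EuclideanSpace ℝ (Fin p)) :
    quadForm (A - B) θ = quadForm A θ - quadForm B θ := by
  simp [quadForm, Matrix.sub_mulVec, dotProduct_sub]

lemma abs_dotProduct_le (x θ : EuclideanSpace ℝ (Fin p)) : |x ⬝ᵥ θ| ≤ ‖x‖ * ‖θ‖ := by
  have h : x ⬝ᵥ θ = inner ℝ x θ := by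
    simp [dotProduct, PiLp.inner_apply, mul_comm]
  rw [h]
  exact abs_real_inner_le_norm x θ

lemma single_mem_sparseSphere {k : ℕ} (hk : 1 ≤ k) (j : Fin p) :
    EuclideanSpace.single j (1 : ℝ) ∈ sparseSphere p k := by
  refine ⟨?_, by simp⟩
  have : {l : Fin p | (EuclideanSpace.single j (1 : ℝ)) l ≠ 0} = {j} := by
    ext l
    simp
  rw [this, Set.ncard_singleton]
  exact hk

lemma ncard_support_sum_signedSingle_le {k : ℕ} (x : Fin k → Fin p × Bool) :
    {j : Fin p | (∑ a, signedSingle (x a) : EuclideanSpace ℝ (Fin p)) j ≠ 0}.ncard ≤ k := by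
  have hsub : {j : Fin p | (∑ a, signedSingle (x a) : EuclideanSpace ℝ (Fin p)) j ≠ 0}
      ⊆ Set.range fun a => (x a).1 := by
    intro j hj
    by_contra hcon
    refine hj ?_
    have : ∀ a, (x a).1 ≠ j := fun a ha => hcon ⟨a, ha⟩
    simp only [WithLp.ofLp_sum, Finset.sum_apply]
    refine Finset.sum_eq_zero fun a _ => ?_
    simp [signedSingle, (this a).symm]
  calc _ ≤ (Set.range fun a => (x a).1).ncard := Set.ncard_le_ncard hsub (Set.toFinite _)
    _ ≤ k := by
      rw [← Set.image_univ]
      exact (Set.ncard_image_le Set.finite_univ).trans (by simp [Set.ncard_univ])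

/-- The set of all sums of `k` signed basis vectors. -/
noncomputable def signedSums (p k : ℕ) : Finset (EuclideanSpace ℝ (Fin p)) := by
  classical
  exact Finset.univ.image fun x : Fin k → Fin p × Bool => ∑ a, signedSingle (x a)

lemma mem_signedSums {k : ℕ} {u : EuclideanSpace ℝ (Fin p)} :
    u ∈ signedSums p k ↔ ∃ x : Fin k → Fin p × Bool, ∑ a, signedSingle (x a) = u := by
  simp [signedSums]

/-- A sum ignores the order of its terms. Counting multisets rather than `k`-tuples is what puts
`np/k`, not `np`, inside the logarithm. -/
lemma card_signedSums_le (p k : ℕ) :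
    (signedSums p k).card ≤ Fintype.card (Sym (Fin p × Bool) k) := by
  classical
  have hsub : signedSums p k ⊆ Finset.univ.image fun s : Sym (Fin p × Bool) k =>
      ((s : Multiset (Fin p × Bool)).map signedSingle).sum := by
    intro u hu
    obtain ⟨x, rfl⟩ := mem_signedSums.1 hu
    refine Finset.mem_image.2 ⟨⟨Finset.univ.val.map x, by simp⟩, Finset.mem_univ _, ?_⟩
    simp [Function.comp_def, List.sum_ofFn]
  exact (Finset.card_le_card hsub).trans Finset.card_image_le

end Gram

/-! ### Fourth moments and variances of linear forms -/

section Moments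

variable {Ω : Type*} [MeasurableSpace Ω] {μ : Measure Ω} {n p k : ℕ}

lemma measurable_dotProduct_const {x : Ω → EuclideanSpace ℝ (Fin p)} (hx : Measurable x)
    (θ : EuclideanSpace ℝ (Fin p)) : Measurable fun ω => x ω ⬝ᵥ θ := by
  simp only [dotProduct]
  fun_prop

lemma memLp_four_dotProduct {x : Ω → EuclideanSpace ℝ (Fin p)}
    (hx : ∀ j, MemLp (fun ω => x ω j) 4 μ) (θ : EuclideanSpace ℝ (Fin p)) :
    MemLp (fun ω => x ω ⬝ᵥ θ) 4 μ :=
  memLp_finsetSum (f := fun j ω => x ω j * θ j) Finset.univ fun j _ => (hx j).mul_const (θ j)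

lemma memLp_sq_of_memLp_four {f : Ω → ℝ} (hf : MemLp f 4 μ) :
    MemLp (fun ω => f ω ^ 2) 2 μ := by
  have hm : AEStronglyMeasurable (fun ω => f ω ^ 2) μ := hf.1.pow 2
  rw [memLp_two_iff_integrable_sq hm]
  have h4 : MemLp f ((4 : ℕ) : ℝ≥0∞) μ := by exact_mod_cast hf
  refine (h4.integrable_norm_pow (by norm_num)).congr (Filter.Eventually.of_forall fun ω => ?_)
  have : |f ω| ^ 4 = (f ω ^ 2) ^ 2 := by rw [← sq_abs (f ω)]; ring
  simpa using this

variable [IsProbabilityMeasure μ]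

lemma memLp_four_of_orliczNorm_lt {α : ℝ} (hα : 0 < α) {f : Ω → ℝ} (hf : Measurable f) {η : ℝ}
    (hη : 0 < η) (h : orliczNorm (psi α) f μ < ENNReal.ofReal η) : MemLp f 4 μ := by
  obtain ⟨c, hc0, hc⟩ := exists_pow_le_mul_exp_rpow hα 4
  have h4 := (integrable_abs_pow_of_orliczNorm_lt hα hf hη h hc hc0.le).1
  rw [← integrable_norm_rpow_iff hf.aestronglyMeasurable (by norm_num) (by norm_num)]
  refine h4.congr (Filter.Eventually.of_forall fun ω => ?_)
  have : (4 : ℝ≥0∞).toReal = ((4 : ℕ) : ℝ) := by simp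
  simp only [this, Real.rpow_natCast, Real.norm_eq_abs]

lemma integrable_mul_of_memLp_four {f g : Ω → ℝ} (hf : MemLp f 4 μ) (hg : MemLp g 4 μ) :
    Integrable (fun ω => f ω * g ω) μ :=
  (hf.mono_exponent (p := 2) (by norm_num)).integrable_mul
    (hg.mono_exponent (p := 2) (by norm_num))

/-- The right side is free of `θ`, so the real supremum in `upsilon` is over a bounded set and not
the default value `0`. -/
lemma variance_sq_dotProduct_le {x : Ω → EuclideanSpace ℝ (Fin p)} (hxm : Measurable x)
    (hx : ∀ j, MemLp (fun ω => x ω j) 4 μ) {θ : EuclideanSpace ℝ (Fin p)} (hθ : ‖θ‖ = 1) :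
    variance (fun ω => (x ω ⬝ᵥ θ) ^ 2) μ ≤ ∫ ω, (∑ j, x ω j ^ 2) ^ 2 ∂μ := by
  have hm := (measurable_dotProduct_const hxm θ).pow_const 2
  refine (variance_le_expectation_sq hm.aestronglyMeasurable).trans ?_
  have hS : MemLp (fun ω => ∑ j, x ω j ^ 2) 2 μ :=
    memLp_finsetSum _ fun j _ => memLp_sq_of_memLp_four (hx j)
  refine integral_mono_of_nonneg (Filter.Eventually.of_forall fun ω => sq_nonneg _)
    hS.integrable_sq (Filter.Eventually.of_forall fun ω => ?_)
  have h1 : (x ω ⬝ᵥ θ) ^ 2 ≤ ∑ j, x ω j ^ 2 := by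
    have h := abs_dotProduct_le (x ω) θ
    rw [hθ, mul_one] at h
    rw [← sq_abs, ← EuclideanSpace.real_norm_sq_eq]
    exact pow_le_pow_left₀ (abs_nonneg _) h 2
  exact pow_le_pow_left₀ (sq_nonneg _) h1 2

lemma sum_variance_le_upsilon (hn : 1 ≤ n) {X : Fin n → Ω → EuclideanSpace ℝ (Fin p)}
    (hXm : ∀ i, Measurable (X i)) (hX : ∀ i j, MemLp (fun ω => X i ω j) 4 μ)
    {θ : EuclideanSpace ℝ (Fin p)} (hθ : θ ∈ sparseSphere p k) :
    ∑ i, variance (fun ω => (X i ω ⬝ᵥ θ) ^ 2) μ ≤ n * upsilon X μ k := by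
  have hn' : (0 : ℝ) < n := by exact_mod_cast hn
  have hbdd : BddAbove (Set.range fun θ : sparseSphere p k => (1 / (n : ℝ)) *
      ∑ i, variance (fun ω => (X i ω ⬝ᵥ (θ : EuclideanSpace ℝ (Fin p))) ^ 2) μ) := by
    refine ⟨(1 / (n : ℝ)) * ∑ i, ∫ ω, (∑ j, X i ω j ^ 2) ^ 2 ∂μ, ?_⟩
    rintro _ ⟨θ, rfl⟩
    exact mul_le_mul_of_nonneg_left (Finset.sum_le_sum fun i _ =>
      variance_sq_dotProduct_le (hXm i) (hX i) θ.2.2) (by positivity)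
  have h : _ ≤ upsilon X μ k := le_ciSup hbdd ⟨θ, hθ⟩
  rwa [one_div, inv_mul_le_iff₀ hn'] at h

end Moments

/-! ### Deviation bounds for single forms and diagonal entries -/

section Concentration

variable {Ω : Type*} [MeasurableSpace Ω] {μ : Measure Ω} [IsProbabilityMeasure μ] {n p k : ℕ}

lemma natCast_mul_sqrt_div (hn : 1 ≤ n) (a : ℝ) : (n : ℝ) * √(a / n) = √(n * a) := by
  have hn' : (0 : ℝ) < n := by exact_mod_cast hn
  rw [← Real.sqrt_sq hn'.le, ← Real.sqrt_mul (by positivity), Real.sqrt_sq hn'.le]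
  congr 1
  field_simp

/-- Lower tail of the sample quadratic form at a sparse unit vector. -/
lemma measureReal_quadForm_lt_le (hn : 1 ≤ n) {X : Fin n → Ω → EuclideanSpace ℝ (Fin p)}
    (hXm : ∀ i, Measurable (X i)) (hind : iIndepFun X μ)
    (hX : ∀ i j, MemLp (fun ω => X i ω j) 4 μ)
    {θ : EuclideanSpace ℝ (Fin p)} (hθ : θ ∈ sparseSphere p k) {M s ξ : ℝ} (hM : 0 < M)
    (hs : 0 ≤ s) (hθM : ∀ i, ∫ ω, (X i ω ⬝ᵥ θ) ^ 2 ∂μ ≤ M)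
    (hξ : 2 * √(upsilon X μ k * s / n) + 2 * M * s / n ≤ ξ) :
    μ.real {ω | quadForm (sampleGram X ω) θ < quadForm (popGram X μ) θ - ξ} ≤ Real.exp (-s) := by
  have hn' : (0 : ℝ) < n := by exact_mod_cast hn
  have key := measureReal_sum_le_le_exp_neg (μ := μ) (Y := fun i ω => (X i ω ⬝ᵥ θ) ^ 2)
    (hind.comp (fun _ x => (x ⬝ᵥ θ) ^ 2)
      fun _ => (measurable_dotProduct_const measurable_id θ).pow_const 2)
    (fun i => (measurable_dotProduct_const (hXm i) θ).pow_const 2)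
    (fun i => memLp_sq_of_memLp_four (memLp_four_dotProduct (hX i) θ))
    (fun i ω => sq_nonneg _) hM hs hθM (sum_variance_le_upsilon hn hXm hX hθ)
  refine (measureReal_mono fun ω hω => ?_).trans key
  simp only [Set.mem_ofPred_eq] at hω ⊢
  rw [quadForm_sampleGram, quadForm_popGram X fun i j l => integrable_mul_of_memLp_four (hX i j) (hX i l)] at hω
  have hξ' : n * (2 * √(upsilon X μ k * s / n) + 2 * M * s / n) ≤ n * ξ := by gcongr
  have e : n * (2 * √(upsilon X μ k * s / n) + 2 * M * s / n)
      = 2 * √(n * upsilon X μ k * s) + 2 * M * s := by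
    rw [mul_assoc (n : ℝ), ← natCast_mul_sqrt_div hn]
    field_simp
  rw [e] at hξ'
  have hω' := mul_lt_mul_of_pos_left hω hn'
  rw [mul_sub, ← mul_assoc, ← mul_assoc, mul_one_div_cancel hn'.ne', one_mul, one_mul] at hω'
  linarith

/-- Upper tail of the diagonal entries of the sample gram matrix. -/
lemma measureReal_diag_gt_le (hn : 1 ≤ n) (hk : 1 ≤ k) {α : ℝ} (hα : 0 < α) (hα2 : α ≤ 2)
    {X : Fin n → Ω → EuclideanSpace ℝ (Fin p)}
    (hXm : ∀ i, Measurable (X i)) (hind : iIndepFun X μ) {η : ℝ} (hη : 0 < η)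
    (hX : ∀ i j, orliczNorm (psi α) (fun ω => X i ω j) μ < ENNReal.ofReal η)
    (j : Fin p) {s ξ : ℝ} (hs : 0 ≤ s)
    (hξ : 2 * √(upsilon X μ k * s / n) + (2 * (η ^ 2 * (2 * Real.log (2 * n)) ^ (2 / α)) * s
      + η ^ 2 * (2 * (s + 1)) ^ (2 / α)) / n ≤ ξ) :
    μ.real {ω | popGram X μ j j + ξ < sampleGram X ω j j} ≤ 2 * Real.exp (-s) := by
  have hn' : (0 : ℝ) < n := by exact_mod_cast hn
  have hXj : ∀ i j, Measurable fun ω => X i ω j := fun i j => by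
    have := hXm i
    fun_prop
  have hL : ∀ i j, MemLp (fun ω => X i ω j) 4 μ := fun i j =>
    memLp_four_of_orliczNorm_lt hα (hXj i j) hη (hX i j)
  have hpow : ∀ i, (fun ω => Real.exp ((X i ω j ^ 2 / η ^ 2) ^ (α / 2)))
      = fun ω => Real.exp ((|X i ω j| / η) ^ α) := by
    intro i
    funext ω
    rw [← sq_abs, ← div_pow, ← Real.rpow_natCast, ← Real.rpow_mul (by positivity)]
    congr 2
    push_cast
    ring
  have hO := fun i => integrable_exp_of_orliczNorm_lt hα (hXj i j) hη (hX i j)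
  have hvar := sum_variance_le_upsilon (k := k) hn hXm hL (single_mem_sparseSphere hk j)
  have hdot : ∀ i ω, X i ω ⬝ᵥ (EuclideanSpace.single j (1 : ℝ)) = X i ω j := by
    intro i ω
    simp
  simp only [hdot] at hvar
  -- Squaring halves the order: `X(j)²` is `α/2`-sub-Weibull at scale `η²`, and `α ≤ 2` makes `α/2 ≤
  -- 1`.
  have key := measureReal_sum_ge_le_two_mul_exp_neg (μ := μ) hn (Y := fun i ω => X i ω j ^ 2)
    (hind.comp (fun _ x => x j ^ 2) fun _ => by fun_prop) (fun i => (hXj i j).pow_const 2)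
    (fun i => memLp_sq_of_memLp_four (hL i j)) (fun i ω => sq_nonneg _) (β := α / 2)
    (L := η ^ 2) (by positivity) (by linarith) (by positivity) hs
    (fun i => by rw [hpow i]; exact (hO i).1) (fun i => by rw [hpow i]; exact (hO i).2) hvar
  refine (measureReal_mono fun ω hω => ?_).trans key
  simp only [Set.mem_ofPred_eq, sampleGram, popGram, Matrix.of_apply, ← sq] at hω ⊢
  rw [one_div_div]
  have hξ' := mul_le_mul_of_nonneg_left hξ hn'.le
  have e : n * (2 * √(upsilon X μ k * s / n) + (2 * (η ^ 2 * (2 * Real.log (2 * n)) ^ (2 / α)) * s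
      + η ^ 2 * (2 * (s + 1)) ^ (2 / α)) / n)
      = 2 * √(n * upsilon X μ k * s) + 2 * (η ^ 2 * (2 * Real.log (2 * n)) ^ (2 / α)) * s
      + η ^ 2 * (2 * (s + 1)) ^ (2 / α) := by
    rw [mul_assoc (n : ℝ), ← natCast_mul_sqrt_div hn]
    field_simp
    ring
  rw [e] at hξ'
  have hω' := mul_lt_mul_of_pos_left hω hn'
  rw [mul_add, ← mul_assoc, ← mul_assoc, mul_one_div_cancel hn'.ne', one_mul, one_mul] at hω'
  linarith

end Concentration

/-! ### Union bound -/

section Uniform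

variable {Ω : Type*} [MeasurableSpace Ω] {μ : Measure Ω} [IsProbabilityMeasure μ] {n p k : ℕ}

lemma RSC_of_signedSums (hk : 2 ≤ k) {A S : Matrix (Fin p) (Fin p) ℝ} (hS : S.IsHermitian)
    {ξ : ℝ} (hξ : 0 ≤ ξ) (hd : ∀ j, A j j ≤ S j j + ξ)
    (hu : ∀ u ∈ signedSums p k, quadForm S u - ξ * ‖u‖ ^ 2 ≤ quadForm A u) :
    RSC A (lambdaMin S) ξ k := by
  intro v
  have h := quadForm_ge_of_signedSingle hk (A - S) hξ
    (fun j => by rw [Matrix.sub_apply]; linarith [hd j])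
    (fun x => by
      rw [quadForm_sub]
      linarith [hu _ (mem_signedSums.2 ⟨x, rfl⟩)]) v
  rw [quadForm_sub] at h
  have h2 := lambdaMin_mul_norm_sq_le_quadForm hS v
  have h3 : 4 * ξ / k * l1Norm v ^ 2 ≤ 54 * ξ / k * l1Norm v ^ 2 := by
    gcongr
    norm_num
  nlinarith [mul_nonneg hξ (sq_nonneg ‖v‖)]

/-- The union bound over the signed sums and the diagonal entries. -/
lemma one_sub_le_measureReal_RSC (hk : 2 ≤ k) {X : Fin n → Ω → EuclideanSpace ℝ (Fin p)}
    {ξ δ : ℝ} (hξ : 0 ≤ ξ) (hδ : 0 ≤ δ)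
    (hlow : ∀ θ ∈ sparseSphere p k,
      μ.real {ω | quadForm (sampleGram X ω) θ < quadForm (popGram X μ) θ - ξ} ≤ δ)
    (hup : ∀ j, μ.real {ω | popGram X μ j j + ξ < sampleGram X ω j j} ≤ 2 * δ) :
    1 - ((signedSums p k).card * δ + p * (2 * δ)) ≤
      μ.real {ω | RSC (sampleGram X ω) (lambdaMin (popGram X μ)) ξ k} := by
  have hlow' : ∀ u ∈ signedSums p k, μ.real {ω | quadForm (sampleGram X ω) u
      < quadForm (popGram X μ) u - ξ * ‖u‖ ^ 2} ≤ δ := by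
    intro u hu
    rcases eq_or_ne u 0 with rfl | hu0
    · have : {ω | quadForm (sampleGram X ω) (0 : EuclideanSpace ℝ (Fin p))
          < quadForm (popGram X μ) 0 - ξ * ‖(0 : EuclideanSpace ℝ (Fin p))‖ ^ 2} = ∅ := by
        ext ω
        simp [quadForm]
      rw [this, measureReal_empty]
      exact hδ
    · have hn : 0 < ‖u‖ := norm_pos_iff.2 hu0
      -- The deviation event is homogeneous of degree two in `u`, so it can be tested on the
      -- normalised vector.
      have hθ : ‖u‖⁻¹ • u ∈ sparseSphere p k := by
        refine ⟨?_, by rw [norm_smul, norm_inv, norm_norm, inv_mul_cancel₀ hn.ne']⟩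
        obtain ⟨x, rfl⟩ := mem_signedSums.1 hu
        refine (Set.ncard_le_ncard (fun j hj => ?_) (Set.toFinite _)).trans
          (ncard_support_sum_signedSingle_le x)
        exact fun h => hj (by rw [PiLp.smul_apply, h, smul_zero])
      refine (measureReal_mono fun ω hω => ?_).trans (hlow _ hθ)
      simp only [Set.mem_ofPred_eq, quadForm_smul] at hω ⊢
      have h2 := mul_lt_mul_of_pos_left hω (show 0 < ‖u‖⁻¹ ^ 2 by positivity)
      have e : ‖u‖⁻¹ ^ 2 * (quadForm (popGram X μ) u - ξ * ‖u‖ ^ 2)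
          = ‖u‖⁻¹ ^ 2 * quadForm (popGram X μ) u - ξ := by
        field_simp
      rwa [e] at h2
  set bad₁ : Set Ω := ⋃ u ∈ signedSums p k, {ω | quadForm (sampleGram X ω) u
      < quadForm (popGram X μ) u - ξ * ‖u‖ ^ 2} with hbad₁
  set bad₂ : Set Ω := ⋃ j : Fin p, {ω | popGram X μ j j + ξ < sampleGram X ω j j} with hbad₂
  have h1 : μ.real bad₁ ≤ (signedSums p k).card * δ := by
    refine (measureReal_biUnion_finset_le _ _).trans ((Finset.sum_le_sum hlow').trans_eq ?_)
    rw [Finset.sum_const, nsmul_eq_mul]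
  have h2 : μ.real bad₂ ≤ p * (2 * δ) := by
    refine (measureReal_iUnion_fintype_le _).trans
      ((Finset.sum_le_sum fun j _ => hup j).trans_eq ?_)
    rw [Finset.sum_const, nsmul_eq_mul, Finset.card_univ, Fintype.card_fin]
  -- Covering the whole space uses subadditivity only, so measurability of the good event is not
  -- needed.
  have hcover : (Set.univ : Set Ω) ⊆
      {ω | RSC (sampleGram X ω) (lambdaMin (popGram X μ)) ξ k} ∪ (bad₁ ∪ bad₂) := by
    intro ω _
    by_cases hb : ω ∈ bad₁ ∪ bad₂
    · exact Or.inr hb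
    · refine Or.inl (RSC_of_signedSums hk (isHermitian_popGram X) hξ (fun j => ?_) fun u hu => ?_)
      · by_contra! hcon
        exact hb (Or.inr (Set.mem_iUnion.2 ⟨j, hcon⟩))
      · by_contra! hcon
        exact hb (Or.inl (Set.mem_biUnion hu hcon))
  have hle := (measureReal_mono hcover (measure_ne_top μ _)).trans
    ((measureReal_union_le _ _).trans
      (add_le_add le_rfl ((measureReal_union_le _ _).trans (add_le_add h1 h2))))
  rw [probReal_univ] at hle
  linarith

/-- The failure probability resulting from the union bound. -/
lemma card_signedSums_mul_exp_le (hk : 2 ≤ k) (hn : 1 ≤ n) (hnp : 3 * (k : ℝ) ≤ n * p) :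
    (signedSums p k).card * Real.exp (-(3 * (k * Real.log (36 * n * p / k))))
      + p * (2 * Real.exp (-(3 * (k * Real.log (36 * n * p / k))))) ≤ 3 * k / (n * p) := by
  have hk' : (2 : ℝ) ≤ k := by exact_mod_cast hk
  have hn' : (1 : ℝ) ≤ n := by exact_mod_cast hn
  have hnp0 : 0 < (n : ℝ) * p := by linarith
  have hx : 0 < 36 * (n : ℝ) * p / k := by
    rw [mul_assoc]
    positivity
  set l := Real.log (36 * n * p / k) with hl
  have hel : Real.exp l = 36 * n * p / k := Real.exp_log hx
  have hl1 : 1 ≤ l := by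
    rw [hl, Real.le_log_iff_exp_le hx, le_div_iff₀ (by linarith)]
    nlinarith [Real.exp_one_lt_d9]
  have hcard : ((signedSums p k).card : ℝ) ≤ Real.exp (k * l) := by
    calc ((signedSums p k).card : ℝ) ≤ Fintype.card (Sym (Fin p × Bool) k) := by
          exact_mod_cast card_signedSums_le p k
      _ ≤ (12 * (3 * n * p / k)) ^ k := by
          refine card_sym_le (by omega) ?_ ?_
          · rw [le_div_iff₀ (by linarith)]
            nlinarith
          · gcongr
            nlinarith [Nat.cast_nonneg (α := ℝ) p]
      -- The radius `r = 3np/k` was chosen so that `12 r = 36np/k = e^l`.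
      _ = Real.exp (k * l) := by
          rw [Real.exp_nat_mul, hel]
          congr 1
          ring
  have hp : (p : ℝ) ≤ Real.exp (k * l + l) := by
    calc (p : ℝ) ≤ k * (36 * n * p / k) := by
          rw [mul_div_cancel₀ _ (by linarith)]
          nlinarith [Nat.cast_nonneg (α := ℝ) p]
      _ ≤ Real.exp (k * l) * Real.exp l := by
          rw [hel]
          gcongr
          nlinarith [Real.add_one_le_exp (k * l)]
      _ = _ := (Real.exp_add _ _).symm
  have e1 : Real.exp (k * l) * Real.exp (-(3 * (k * l))) ≤ Real.exp (-l) := by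
    rw [← Real.exp_add]
    gcongr
    nlinarith
  have e2 : Real.exp (k * l + l) * Real.exp (-(3 * (k * l))) ≤ Real.exp (-l) := by
    rw [← Real.exp_add]
    gcongr
    nlinarith
  have e3 : Real.exp (-l) = k / (36 * n * p) := by
    rw [Real.exp_neg, hel, inv_div]
  have hE := Real.exp_pos (-(3 * (k * l)))
  have e4 : 3 * Real.exp (-l) ≤ 3 * k / (n * p) := by
    rw [e3, mul_div_assoc, mul_assoc 36]
    exact mul_le_mul_of_nonneg_left
      (div_le_div_of_nonneg_left (by positivity) hnp0 (by linarith)) (by norm_num)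
  nlinarith [mul_le_mul_of_nonneg_right hcard hE.le, mul_le_mul_of_nonneg_right hp hE.le]

end Uniform

/-! ### Choice of the constant and the two cases -/

section Main

/-- The common form of `xiM` (with `κ = k`) and `xiJ` (with `κ = 1`). -/
noncomputable def xi (C α K U κ : ℝ) (n p k : ℕ) : ℝ :=
  14 * √2 * √(U * k * Real.log (36 * n * p / k) / n)
    + C * K ^ 2 * κ * Real.log (2 * n) ^ (2 / α) * (k * Real.log (36 * n * p / k)) ^ (2 / α) / n

variable {Ω : Type*} [MeasurableSpace Ω] {μ : Measure Ω} {n p k : ℕ}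

lemma orliczNorm_coord_le_marginalNorm (α : ℝ) (x : Ω → EuclideanSpace ℝ (Fin p)) (j : Fin p) :
    orliczNorm (psi α) (fun ω => x ω j) μ ≤ marginalNorm α x μ :=
  le_iSup (fun j : Fin p => orliczNorm (psi α) (fun ω => x ω j) μ) j

lemma orliczNorm_dotProduct_le_jointNorm (α : ℝ) (x : Ω → EuclideanSpace ℝ (Fin p))
    {θ : EuclideanSpace ℝ (Fin p)} (hθ : ‖θ‖ = 1) :
    orliczNorm (psi α) (fun ω => x ω ⬝ᵥ θ) μ ≤ jointNorm α x μ :=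
  le_iSup₂ (f := fun (θ : EuclideanSpace ℝ (Fin p)) (_ : ‖θ‖ = 1) =>
    orliczNorm (psi α) (fun ω => x ω ⬝ᵥ θ) μ) θ hθ

lemma orliczNorm_coord_le_jointNorm (α : ℝ) (x : Ω → EuclideanSpace ℝ (Fin p)) (j : Fin p) :
    orliczNorm (psi α) (fun ω => x ω j) μ ≤ jointNorm α x μ := by
  simpa using orliczNorm_dotProduct_le_jointNorm (μ := μ) α x
    (θ := EuclideanSpace.single j (1 : ℝ)) (by simp)

variable [IsProbabilityMeasure μ]

/-- The case `K = 0` is separate because the tail bounds need a positive scale. Letting `η ↓ 0` in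
the second moment bound gives `X = 0` almost surely, so both Gram matrices vanish. -/
lemma RSC_of_norm_bound_zero {α : ℝ} (hα : 0 < α) {c : ℝ} (hc0 : 0 ≤ c)
    (hc : ∀ x : ℝ, 0 ≤ x → x ^ 2 ≤ c * Real.exp (x ^ α))
    {X : Fin n → Ω → EuclideanSpace ℝ (Fin p)} (hXm : ∀ i, Measurable (X i))
    (hX : ∀ i j, orliczNorm (psi α) (fun ω => X i ω j) μ = 0) {ξ : ℝ} (hξ : 0 ≤ ξ) :
    μ.real {ω | RSC (sampleGram X ω) (lambdaMin (popGram X μ)) ξ k} = 1 := by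
  have hXj : ∀ i j, Measurable fun ω => X i ω j := fun i j => by
    have := hXm i
    fun_prop
  have hz : ∀ i j, ∀ᵐ ω ∂μ, X i ω j = 0 := by
    intro i j
    have hb : ∀ η : ℝ, 0 < η → _ := fun η hη =>
      integrable_abs_pow_of_orliczNorm_lt hα (hXj i j) hη
        (by rw [hX i j]; exact ENNReal.ofReal_pos.2 hη) hc hc0
    have h0 : ∫ ω, |X i ω j| ^ 2 ∂μ = 0 := by
      refine le_antisymm (ge_of_tendsto (x := nhdsWithin (0 : ℝ) (Set.Ioi 0))
        (f := fun η : ℝ => 2 * c * η ^ 2) ?_ ?_) (integral_nonneg fun ω => by positivity)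
      · have : Filter.Tendsto (fun η : ℝ => 2 * c * η ^ 2) (nhds 0) (nhds (2 * c * 0 ^ 2)) :=
          (by fun_prop : Continuous fun η : ℝ => 2 * c * η ^ 2).tendsto 0
        simp only [ne_eq, OfNat.ofNat_ne_zero, not_false_eq_true, zero_pow, mul_zero] at this
        exact this.mono_left nhdsWithin_le_nhds
      · filter_upwards [self_mem_nhdsWithin] with η hη using (hb η hη).2
    rw [integral_eq_zero_iff_of_nonneg (fun ω => by positivity) (hb 1 one_pos).1] at h0
    filter_upwards [h0] with ω hω
    simpa using hω
  have hpop : popGram X μ = 0 := by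
    ext j l
    have : ∀ i, ∫ ω, X i ω j * X i ω l ∂μ = 0 := fun i => by
      rw [integral_eq_zero_of_ae]
      filter_upwards [hz i j] with ω hω
      simp [hω]
    simp [popGram, this]
  have hae : ∀ᵐ ω ∂μ, RSC (sampleGram X ω) (lambdaMin (popGram X μ)) ξ k := by
    have := ae_all_iff.2 fun i => ae_all_iff.2 (hz i)
    filter_upwards [this] with ω hω v
    have h1 : sampleGram X ω = 0 := by
      ext j l
      simp [sampleGram, hω]
    have h2 := lambdaMin_mul_norm_sq_le_quadForm (isHermitian_popGram (μ := μ) X) v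
    have h3 : quadForm (0 : Matrix (Fin p) (Fin p) ℝ) v = 0 := by simp [quadForm]
    rw [h1, h3]
    rw [hpop] at h2 ⊢
    rw [h3] at h2
    have h4 : 0 ≤ 54 * ξ / k * l1Norm v ^ 2 := by positivity
    nlinarith [mul_nonneg hξ (sq_nonneg ‖v‖)]
  rw [measureReal_def, (prob_compl_eq_zero_iff₀ ?_).1 hae]
  · simp
  · exact NullMeasurableSet.of_compl (NullMeasurableSet.of_null hae)

/-- Both cases of the restricted strong convexity bound: `κ` is the factor by which second
moments of sparse linear forms may exceed those of the coordinates. -/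
lemma exists_const_RSC {α : ℝ} (hα : 0 < α) (hα2 : α ≤ 2) {c : ℝ} (hc0 : 0 < c)
    (hc : ∀ x : ℝ, 0 ≤ x → x ^ 2 ≤ c * Real.exp (x ^ α)) :
    ∃ C : ℝ, 0 < C ∧ ∀ (Ω : Type*) [MeasurableSpace Ω] (μ : Measure Ω) [IsProbabilityMeasure μ]
      (n p k : ℕ) (_ : 1 ≤ n) (_ : 1 ≤ p) (_ : 2 ≤ k)
      (X : Fin n → Ω → EuclideanSpace ℝ (Fin p)) (_ : ∀ i, Measurable (X i))
      (_ : iIndepFun X μ) (K : ℝ≥0) (κ : ℝ) (_ : 1 ≤ κ)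
      (_ : ∀ i j, orliczNorm (psi α) (fun ω => X i ω j) μ ≤ K)
      (_ : ∀ θ ∈ sparseSphere p k, ∀ i, ∀ η : ℝ, K < η →
        ∫ ω, (X i ω ⬝ᵥ θ) ^ 2 ∂μ ≤ κ * (2 * c * η ^ 2)),
      1 - 3 * (k : ℝ) / (n * p) ≤ μ.real {ω | RSC (sampleGram X ω) (lambdaMin (popGram X μ))
        (xi C α K (upsilon X μ k) κ n p k) k} := by
  set b : ℝ := Real.log 2 ^ (2 / α) with hb
  have hb0 : 0 < b := Real.rpow_pos_of_pos (Real.log_pos one_lt_two) _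
  -- The three terms pay, in order, for the linear Bernstein term of the lower tail, that of the
  -- truncated diagonal, and the excess. Dividing by `b` inserts a logarithmic factor, since `b ≤
  -- (log 2n)^(2/α)`.
  refine ⟨48 * c / b + 24 * 2 ^ (2 / α) + 4 * 8 ^ (2 / α) / b, by positivity, ?_⟩
  set C : ℝ := 48 * c / b + 24 * 2 ^ (2 / α) + 4 * 8 ^ (2 / α) / b with hC
  intro Ω _ μ _ n p k hn hp hk X hXm hind K κ hκ hX hsec
  have hk' : (2 : ℝ) ≤ k := by exact_mod_cast hk
  have hn' : (1 : ℝ) ≤ n := by exact_mod_cast hn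
  -- If `np < 3k` the claimed probability is negative; otherwise `log(36np/k) ≥ 1`.
  rcases lt_or_ge ((n : ℝ) * p) (3 * k) with hnp | hnp
  · refine le_trans ?_ measureReal_nonneg
    have hp' : (1 : ℝ) ≤ p := by exact_mod_cast hp
    rw [sub_nonpos, le_div_iff₀ (by positivity)]
    linarith
  rcases eq_or_ne K 0 with hK | hK
  · have h1 := RSC_of_norm_bound_zero (k := k) hα hc0.le hc hXm
      (fun i j => by simpa [hK] using hX i j)
      (ξ := xi C α K (upsilon X μ k) κ n p k) (by simp [xi, hK]; positivity)
    rw [h1]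
    have : 0 ≤ 3 * (k : ℝ) / (n * p) := by positivity
    linarith
  have hK0 : (0 : ℝ) < K := by exact_mod_cast pos_iff_ne_zero.2 hK
  set U := upsilon X μ k with hU
  set q := k * Real.log (36 * n * p / k) with hq
  have hq1 : 1 ≤ q := by
    have hnp0 : 0 < (n : ℝ) * p := by linarith
    have hl1 : 1 ≤ Real.log (36 * n * p / k) := by
      rw [Real.le_log_iff_exp_le (by rw [mul_assoc]; positivity), le_div_iff₀ (by linarith)]
      nlinarith [Real.exp_one_lt_d9]
    nlinarith
  have hα1 : 1 ≤ 2 / α := by rw [le_div_iff₀ hα]; linarith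
  have hqα : q ≤ q ^ (2 / α) := by
    simpa using Real.rpow_le_rpow_of_exponent_le hq1 hα1
  set Lg := Real.log (2 * n) ^ (2 / α) with hLg
  have hlog2 : 0 < Real.log 2 := Real.log_pos one_lt_two
  have hlogle : Real.log 2 ≤ Real.log (2 * n) := Real.log_le_log two_pos (by linarith)
  have hbL : b ≤ Lg := Real.rpow_le_rpow hlog2.le hlogle (by positivity)
  have hLg0 : 0 < Lg := hb0.trans_le hbL
  set Q := q ^ (2 / α) with hQ
  have hQ0 : 0 < Q := by positivity
  set ξ := xi C α K U κ n p k with hξdef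
  have hξeq : ξ = 14 * √2 * √(U * q / n) + C * K ^ 2 * κ * Lg * Q / n := by
    rw [hξdef, xi, hQ, hq, mul_assoc U]
  have hsqrt : 2 * √(U * (3 * q) / n) ≤ 14 * √2 * √(U * q / n) := by
    have e : U * (3 * q) / n = 3 * (U * q / n) := by ring
    have h3 : √3 ≤ 2 := by
      rw [Real.sqrt_le_left (by norm_num)]
      norm_num
    have h2 : 1 ≤ √2 := by
      rw [Real.one_le_sqrt]
      norm_num
    rw [e, Real.sqrt_mul (by norm_num)]
    nlinarith [Real.sqrt_nonneg (U * q / n),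
      mul_le_mul_of_nonneg_right h3 (Real.sqrt_nonneg (U * q / n)),
      mul_le_mul_of_nonneg_right h2 (Real.sqrt_nonneg (U * q / n))]
  have hC0 : 0 < C := by positivity
  -- The scale `2K` gives the strict inequality needed to use the Orlicz bound; its factor `4`
  -- enters the constants.
  have hη : (K : ℝ) < 2 * K := by linarith
  have hX' : ∀ i j, orliczNorm (psi α) (fun ω => X i ω j) μ < ENNReal.ofReal (2 * K) :=
    fun i j => (hX i j).trans_lt (by
      rw [← ENNReal.ofReal_coe_nnreal, ENNReal.ofReal_lt_ofReal_iff (by positivity)]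
      exact hη)
  have hL : ∀ i j, MemLp (fun ω => X i ω j) 4 μ := fun i j =>
    memLp_four_of_orliczNorm_lt hα (by have := hXm i; fun_prop) (by positivity) (hX' i j)
  refine le_trans (sub_le_sub_left (card_signedSums_mul_exp_le hk hn hnp) 1)
    (one_sub_le_measureReal_RSC hk (by rw [hξeq]; positivity) (Real.exp_pos _).le (fun θ hθ => ?_) fun j => ?_)
  · refine measureReal_quadForm_lt_le hn hXm hind hL hθ (M := κ * (2 * c * (2 * K) ^ 2))
      (by positivity) (by positivity) (fun i => hsec θ hθ i _ hη) ?_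
    rw [hξeq]
    refine add_le_add hsqrt (div_le_div_of_nonneg_right ?_ (by positivity))
    have h1 : 48 * c * q ≤ C * (Lg * Q) := by
      calc 48 * c * q ≤ 48 * c * Q := by gcongr
        _ = 48 * c / b * (b * Q) := by field_simp
        _ ≤ C * (Lg * Q) := by
          gcongr
          rw [hC]
          have : 0 ≤ 24 * (2 : ℝ) ^ (2 / α) + 4 * 8 ^ (2 / α) / b := by positivity
          linarith
    calc 2 * (κ * (2 * c * (2 * K) ^ 2)) * (3 * q) = K ^ 2 * κ * (48 * c * q) := by ring
      _ ≤ K ^ 2 * κ * (C * (Lg * Q)) := by gcongr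
      _ = _ := by ring
  · refine measureReal_diag_gt_le (k := k) hn (by omega) hα hα2 hXm hind (η := 2 * K) (by positivity)
      hX' j (by positivity) ?_
    rw [hξeq]
    refine add_le_add hsqrt (div_le_div_of_nonneg_right ?_ (by positivity))
    rw [Real.mul_rpow (by norm_num) (hlog2.le.trans hlogle), ← hLg]
    -- Here `s = 3q`, and `2(3q + 1) ≤ 8q` because `q ≥ 1`.
    have h1 : (2 * (3 * q + 1)) ^ (2 / α) ≤ 8 ^ (2 / α) / b * (Lg * Q) := by
      calc (2 * (3 * q + 1)) ^ (2 / α) ≤ (8 * q) ^ (2 / α) :=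
            Real.rpow_le_rpow (by positivity) (by linarith) (by positivity)
        _ = 8 ^ (2 / α) * Q := Real.mul_rpow (by norm_num) (by positivity)
        _ = 8 ^ (2 / α) / b * (b * Q) := by field_simp
        _ ≤ _ := by gcongr
    calc 2 * ((2 * (K : ℝ)) ^ 2 * (2 ^ (2 / α) * Lg)) * (3 * q)
          + (2 * (K : ℝ)) ^ 2 * (2 * (3 * q + 1)) ^ (2 / α)
        ≤ 2 * ((2 * (K : ℝ)) ^ 2 * (2 ^ (2 / α) * Lg)) * (3 * Q)
          + (2 * (K : ℝ)) ^ 2 * (8 ^ (2 / α) / b * (Lg * Q)) := by gcongr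
      _ = K ^ 2 * 1 * Lg * Q * (24 * 2 ^ (2 / α) + 4 * 8 ^ (2 / α) / b) := by ring
      _ ≤ K ^ 2 * κ * Lg * Q * C := by
        gcongr
        rw [hC]
        have : 0 ≤ 48 * c / b := by positivity
        linarith
      _ = _ := by ring

/-- Sparse linear forms have second moments controlled by those of the coordinates. -/
lemma integral_sq_dotProduct_le_of_coord {x : Ω → EuclideanSpace ℝ (Fin p)}
    (hx : ∀ j, MemLp (fun ω => x ω j) 4 μ) {B : ℝ} (hB0 : 0 ≤ B)
    (hB : ∀ j, ∫ ω, x ω j ^ 2 ∂μ ≤ B)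
    {θ : EuclideanSpace ℝ (Fin p)} (hθ : θ ∈ sparseSphere p k) :
    ∫ ω, (x ω ⬝ᵥ θ) ^ 2 ∂μ ≤ k * B := by
  classical
  set T : Finset (Fin p) := Finset.univ.filter fun j => θ j ≠ 0 with hT
  have hTk : (T.card : ℝ) ≤ k := by
    have h := hθ.1
    rw [Set.ncard_eq_toFinset_card'] at h
    have e : Set.toFinset {j : Fin p | θ j ≠ 0} = T := by
      ext j
      simp [hT]
    rw [e] at h
    exact_mod_cast h
  have hi : ∀ j, Integrable (fun ω => x ω j ^ 2) μ := fun j =>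
    (memLp_sq_of_memLp_four (hx j)).integrable one_le_two
  have hpt : ∀ ω, (x ω ⬝ᵥ θ) ^ 2 ≤ ∑ j ∈ T, x ω j ^ 2 := by
    intro ω
    have h1 : x ω ⬝ᵥ θ = ∑ j ∈ T, x ω j * θ j := by
      rw [dotProduct, hT, Finset.sum_filter]
      refine Finset.sum_congr rfl fun j _ => ?_
      by_cases h : θ j = 0 <;> simp [h]
    have h2 : ∑ j ∈ T, θ j ^ 2 ≤ 1 := by
      calc ∑ j ∈ T, θ j ^ 2 ≤ ∑ j, θ j ^ 2 :=
            Finset.sum_le_sum_of_subset_of_nonneg (Finset.subset_univ _) fun _ _ _ => sq_nonneg _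
        _ = 1 := by rw [← EuclideanSpace.real_norm_sq_eq, hθ.2, one_pow]
    rw [h1]
    refine (Finset.sum_mul_sq_le_sq_mul_sq T _ _).trans ?_
    exact mul_le_of_le_one_right (Finset.sum_nonneg fun _ _ => sq_nonneg _) h2
  calc ∫ ω, (x ω ⬝ᵥ θ) ^ 2 ∂μ ≤ ∫ ω, ∑ j ∈ T, x ω j ^ 2 ∂μ :=
        integral_mono_of_nonneg (Filter.Eventually.of_forall fun ω => sq_nonneg _)
          (integrable_finsetSum _ fun j _ => hi j) (Filter.Eventually.of_forall hpt)
    _ = ∑ j ∈ T, ∫ ω, x ω j ^ 2 ∂μ := integral_finsetSum _ fun j _ => hi j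
    _ ≤ ∑ _j ∈ T, B := Finset.sum_le_sum fun j _ => hB j
    _ = T.card * B := by rw [Finset.sum_const, nsmul_eq_mul]
    _ ≤ k * B := by gcongr

end Main

end SubWeibull

theorem mainTheorem7 (α : ℝ) (hα : 0 < α) (hα2 : α ≤ 2) :
    ∃ C : ℝ, 0 < C ∧
      ∀ (Ω : Type*) [MeasurableSpace Ω] (μ : Measure Ω) [IsProbabilityMeasure μ]
        (n p k : ℕ) (_ : 1 ≤ n) (_ : 1 ≤ p) (_ : 2 ≤ k)
        (X : Fin n → Ω → EuclideanSpace ℝ (Fin p)) (_ : ∀ i, Measurable (X i))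
        (_ : iIndepFun X μ) (K : ℝ≥0),
        -- (a) marginal sub-Weibull covariates
        ((∀ i, SubWeibull.marginalNorm α (X i) μ ≤ K) →
          let lam := SubWeibull.lambdaMin (SubWeibull.popGram X μ)
          let Ξ := SubWeibull.xiM C α K (SubWeibull.upsilon X μ k) n p k
          1 - 3 * (k : ℝ) / (n * p) ≤
              μ.real {ω | SubWeibull.RSC (SubWeibull.sampleGram X ω) lam Ξ k} ∧
          (0 < lam → 1782 * Ξ ≤ lam →
            (∀ ω, SubWeibull.RSC (SubWeibull.sampleGram X ω) lam Ξ k →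
              SubWeibull.RestrictedEigenvalue (SubWeibull.sampleGram X ω) k 3 (lam / 2)) ∧
            1 - 3 * (k : ℝ) / (n * p) ≤
              μ.real {ω | SubWeibull.RestrictedEigenvalue
                (SubWeibull.sampleGram X ω) k 3 (lam / 2)})) ∧
        -- (b) joint sub-Weibull covariates
        ((∀ i, SubWeibull.jointNorm α (X i) μ ≤ K) →
          let lam := SubWeibull.lambdaMin (SubWeibull.popGram X μ)
          let Ξ := SubWeibull.xiJ C α K (SubWeibull.upsilon X μ k) n p k
          1 - 3 * (k : ℝ) / (n * p) ≤
              μ.real {ω | SubWeibull.RSC (SubWeibull.sampleGram X ω) lam Ξ k} ∧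
          (0 < lam → 1782 * Ξ ≤ lam →
            (∀ ω, SubWeibull.RSC (SubWeibull.sampleGram X ω) lam Ξ k →
              SubWeibull.RestrictedEigenvalue (SubWeibull.sampleGram X ω) k 3 (lam / 2)) ∧
            1 - 3 * (k : ℝ) / (n * p) ≤
              μ.real {ω | SubWeibull.RestrictedEigenvalue
                (SubWeibull.sampleGram X ω) k 3 (lam / 2)})) := by
  obtain ⟨c, hc0, hc⟩ := SubWeibull.exists_pow_le_mul_exp_rpow hα 2
  obtain ⟨C, hC0, hC⟩ := SubWeibull.exists_const_RSC hα hα2 hc0 hc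
  refine ⟨C, hC0, ?_⟩
  intro Ω _ μ _ n p k hn hp hk X hXm hind K
  have conclude : ∀ Ξ : ℝ,
      1 - 3 * (k : ℝ) / (n * p) ≤ μ.real {ω | SubWeibull.RSC (SubWeibull.sampleGram X ω)
        (SubWeibull.lambdaMin (SubWeibull.popGram X μ)) Ξ k} →
      _ ∧ (0 < SubWeibull.lambdaMin (SubWeibull.popGram X μ) →
        1782 * Ξ ≤ SubWeibull.lambdaMin (SubWeibull.popGram X μ) → _ ∧ _) := fun Ξ h =>
    ⟨h, fun hlam hΞ =>
      have hRE : ∀ ω, SubWeibull.RSC (SubWeibull.sampleGram X ω)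
          (SubWeibull.lambdaMin (SubWeibull.popGram X μ)) Ξ k →
          SubWeibull.RestrictedEigenvalue (SubWeibull.sampleGram X ω) k 3
            (SubWeibull.lambdaMin (SubWeibull.popGram X μ) / 2) :=
        fun ω hω => hω.restrictedEigenvalue (by omega) hlam hΞ
      ⟨hRE, h.trans (measureReal_mono hRE)⟩⟩
  have hlt : ∀ η : ℝ, K < η → (K : ℝ≥0∞) < ENNReal.ofReal η := fun η hη => by
    rw [← ENNReal.ofReal_coe_nnreal,
      ENNReal.ofReal_lt_ofReal_iff (lt_of_le_of_lt K.coe_nonneg hη)]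
    exact hη
  refine ⟨fun hX => conclude _ ?_, fun hX => conclude _ ?_⟩
  · have hX' := fun i j => (SubWeibull.orliczNorm_coord_le_marginalNorm α (X i) j).trans (hX i)
    -- Coordinatewise control costs `κ = k` in the second moment of a sparse form.
    have h := hC Ω μ n p k hn hp hk X hXm hind K k (by exact_mod_cast (by omega : 1 ≤ k)) hX'
      fun θ hθ i η hη => by
        have hη0 : 0 < η := lt_of_le_of_lt K.coe_nonneg hη
        have hm : ∀ j, Measurable fun ω => X i ω j := fun j => by
          have := hXm i
          fun_prop
        refine SubWeibull.integral_sq_dotProduct_le_of_coord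
          (fun j => SubWeibull.memLp_four_of_orliczNorm_lt hα (hm j) hη0
            ((hX' i j).trans_lt (hlt η hη))) (by positivity) (fun j => ?_) hθ
        simpa using (SubWeibull.integrable_abs_pow_of_orliczNorm_lt hα (hm j) hη0
          ((hX' i j).trans_lt (hlt η hη)) hc hc0.le).2
    exact h
  -- The joint norm controls every unit direction directly, so `κ = 1`.
  · have h := hC Ω μ n p k hn hp hk X hXm hind K 1 le_rfl
      (fun i j => (SubWeibull.orliczNorm_coord_le_jointNorm α (X i) j).trans (hX i))
      fun θ hθ i η hη => by
        rw [one_mul]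
        simpa using (SubWeibull.integrable_abs_pow_of_orliczNorm_lt hα
          (SubWeibull.measurable_dotProduct_const (hXm i) θ) (lt_of_le_of_lt K.coe_nonneg hη)
          (((SubWeibull.orliczNorm_dotProduct_le_jointNorm α (X i) hθ.2).trans (hX i)).trans_lt
            (hlt η hη)) hc hc0.le).2
    simpa only [SubWeibull.xi, SubWeibull.xiJ, mul_one] using h
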